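/- Let $N\ge 1$ be an integer, $s\in(0,1)$, and let $2^*_s=\frac{2N}{N-2s}$ if $2s<N$ and $2^*_s=+\infty$ otherwise. Let $q\in(1,2^*_s)$. For an open set $\Omega\subset\mathbb R^N$ let $\mathcal D^{s,2}_0(\Omega)$ be the completion of $C^\infty_0(\Omega)$ with respect to the norm whose square is $$\int_{\mathbb R^N}\int_{\mathbb R^N}\frac{(u(x)-u(y))^2}{|x-y|^{N+2s}}\,dx\,dy ,$$ and let $\mathfrak S(\Omega,s,q)$ be the set of the critical values of this double integral along $\{u\in\mathcal D^{s,2}_0(\Omega):\int_\Omega|u|^q\,dx=1\}$. A $q$-semilinear $s$-eigenfunction corresponding to $\lambda\in\mathfrak S(\Omega,s,q)$ is a $u\in\mathcal D^{s,2}_0(\Omega)$, $u\ne0$, such that $$\int_{\mathbb R^N}\int_{\mathbb R^N}\frac{(u(x)-u(y))(\varphi(x)-\varphi(y))}{|x-y|^{N+2s}}\,dx\,dy=\lambda\,\|u\|_{L^q(\Omega)}^{2-q}\int_\Omega|u|^{q-2}u\,\varphi\,dx\qquad\text{for all }\varphi\in\mathcal D^{s,2}_0(\Omega).$$ Assume that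 the embedding $\mathcal D^{s,2}_0(\Omega)\hookrightarrow L^q(\Omega)$ is compact, let $\lambda\in\mathfrak S(\Omega,s,q)$, and let $u$ be a corresponding $q$-semilinear $s$-eigenfunction. Then: (a) if $2^*_s<+\infty$, then $\|u\|_{L^\infty(\Omega)}\le \mathcal C_1\,\lambda^{\frac{2^*_s}{2(2^*_s-q)}}\,\|u\|_{L^q(\Omega)}$, with a constant $\mathcal C_1>0$ that depends only on $N,s,q$; (b) if $2^*_s=+\infty$, then $\|u\|_{L^\infty(\Omega)}\le \mathcal C_2\,\lambda\,\|u\|_{L^q(\Omega)}$, with a constant $\mathcal C_2>0$ that depends only on $N,s,q$ and $|\Omega|$ if $|\Omega|<+\infty$, and only on $N,s,q$ and $\Omega$ if $|\Omega|=+\infty$. -/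

import Mathlib

open MeasureTheory Filter Topology Set
open scoped ENNReal ContDiff

namespace FracSemilinear

noncomputable section

/-- Euclidean space `ℝ^N`. -/
abbrev Space (N : ℕ) : Type := EuclideanSpace ℝ (Fin N)

/-- The fractional Sobolev conjugate exponent `2^*_s`: it is `2N/(N-2s)` if `2s < N`, and `+∞`
otherwise. -/
def sobolevConj (N : ℕ) (s : ℝ) : ℝ≥0∞ :=
  if 2 * s < N then ENNReal.ofReal (2 * N / (N - 2 * s)) else ⊤

/-- The double integral `∫∫ (u(x)-u(y))² / |x-y|^{N+2s} dx dy`, with values in `[0,∞]`. -/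
def energy {N : ℕ} (s : ℝ) (u : Space N → ℝ) : ℝ≥0∞ :=
  ∫⁻ x, ∫⁻ y, ENNReal.ofReal ((u x - u y) ^ 2 / ‖x - y‖ ^ ((N : ℝ) + 2 * s))

/-- The double integral `∫∫ (u(x)-u(y))(φ(x)-φ(y)) / |x-y|^{N+2s} dx dy`. On functions of finite
energy the integrand is absolutely integrable on the product space. -/
def energyForm {N : ℕ} (s : ℝ) (u φ : Space N → ℝ) : ℝ :=
  ∫ x, ∫ y, (u x - u y) * (φ x - φ y) / ‖x - y‖ ^ ((N : ℝ) + 2 * s)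

/-- `φ ∈ C^∞_0(Ω)`: smooth, with compact support contained in `Ω`. -/
def IsTestFunction {N : ℕ} (Ω : Set (Space N)) (φ : Space N → ℝ) : Prop :=
  ContDiff ℝ ∞ φ ∧ HasCompactSupport φ ∧ tsupport φ ⊆ Ω

/-- The completion of `C^∞_0(Ω)` for the norm `energy^{1/2}`, realised as a space of functions: its
elements are the limits of sequences of test functions that are Cauchy for that norm. As soon as
the norm controls an `L^q` norm on test functions (in particular, whenever the embedding into
`L^q(Ω)` is compact), every class of Cauchy sequences has, along a subsequence, an almost everywhere
limit, this limit is unique almost everywhere, it determines the class, and its energy is the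
square of the norm of the class; so these are exactly the elements of the metric completion. -/
def D0 {N : ℕ} (Ω : Set (Space N)) (s : ℝ) : Set (Space N → ℝ) :=
  {u | ∃ φ : ℕ → Space N → ℝ, (∀ n, IsTestFunction Ω (φ n)) ∧
    Tendsto (fun p : ℕ × ℕ => energy s (φ p.1 - φ p.2)) atTop (𝓝 0) ∧
    ∀ᵐ x, Tendsto (fun n => φ n x) atTop (𝓝 (u x))}

/-- The `L^q(Ω)` norm, with values in `[0,∞]`. -/
def normLq {N : ℕ} (Ω : Set (Space N)) (q : ℝ) (u : Space N → ℝ) : ℝ≥0∞ :=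
  eLpNorm u (ENNReal.ofReal q) (volume.restrict Ω)

/-- The embedding of the energy space into `L^q(Ω)` is (well defined and) compact: every sequence
that is bounded in energy has a subsequence that converges in `L^q(Ω)`. -/
def CompactEmbedding {N : ℕ} (Ω : Set (Space N)) (s q : ℝ) : Prop :=
  (∀ u ∈ D0 Ω s, MemLp u (ENNReal.ofReal q) (volume.restrict Ω)) ∧
  ∀ u : ℕ → Space N → ℝ, (∀ n, u n ∈ D0 Ω s) →
    (∃ R : ℝ, ∀ n, energy s (u n) ≤ ENNReal.ofReal R) →
    ∃ v : Space N → ℝ, MemLp v (ENNReal.ofReal q) (volume.restrict Ω) ∧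
      ∃ k : ℕ → ℕ, StrictMono k ∧ Tendsto (fun n => normLq Ω q (u (k n) - v)) atTop (𝓝 0)

/-- `u` is a critical point of the energy along the constraint `∫_Ω |u|^q = 1`: the derivative of
the energy at `u` vanishes in every direction in which the derivative at `u` of the functional that
defines the constraint vanishes. -/
def IsConstrainedCriticalPoint {N : ℕ} (Ω : Set (Space N)) (s q : ℝ) (u : Space N → ℝ) : Prop :=
  u ∈ D0 Ω s ∧ (∫ x in Ω, |u x| ^ q) = 1 ∧
  ∀ φ ∈ D0 Ω s, HasDerivAt (fun t : ℝ => ∫ x in Ω, |u x + t * φ x| ^ q) 0 0 →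
    HasDerivAt (fun t : ℝ => (energy s (u + t • φ)).toReal) 0 0

/-- The `q`-semilinear `s`-spectrum of `Ω`: the constrained critical values. -/
def spectrumS {N : ℕ} (Ω : Set (Space N)) (s q : ℝ) : Set ℝ :=
  {lam | ∃ u, IsConstrainedCriticalPoint Ω s q u ∧ lam = (energy s u).toReal}

/-- `u` is a `q`-semilinear `s`-eigenfunction of `Ω` for `lam`: a non-trivial weak solution in the
energy space of `(-Δ)^s u = lam ‖u‖_q^{2-q} |u|^{q-2} u`. -/
def IsEigenfunction {N : ℕ} (Ω : Set (Space N)) (s q lam : ℝ) (u : Space N → ℝ) : Prop :=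
  u ∈ D0 Ω s ∧ ¬ (u =ᵐ[volume] 0) ∧
  ∀ φ ∈ D0 Ω s, energyForm s u φ =
    lam * (normLq Ω q u).toReal ^ (2 - q) * ∫ x in Ω, |u x| ^ (q - 2) * u x * φ x

end

end FracSemilinear

/-! ### The energy as an integral over pairs of points; test functions have finite energy. -/

namespace FracSemilinear

/-! The bound is De Giorgi's iteration, run on a Sobolev-type inequality `‖v‖_p² ≤ c E(v)` with `p >
max(2, q)`. Testing the equation with a regularised truncation `(u - k)₊` gives, for every `k ≥ 0`,
`‖(u - k)₊‖_p² ≤ c λ ‖u‖_q^{2-q} ∫ u₊^{q-1} (u - k)₊` (`IsEigenfunction.lintegral_truncation_le`).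
Along levels increasing to a suitable `K`, this is a superlinear recursion (exponent `p/2 > 1`) for
`∫ (u - k)₊^p`, which forces `u ≤ K`. The same applies to `-u`. Rescaling the function and the
measure gives `K = const · (cλ)^{p/(2(p-q))} ‖u‖_q` (`ae_le_deGiorgiBound_mul`).

The embeddings come from one elementary estimate, `le_lintegral_energyDensity`: if `v` differs from
`v x` by at least `τ` off a set of measure at most `a`, then in a ball of measure `2a` about `x` at
least half of the points contribute to the fibre of the energy at `x`. Taking for the exceptional
set `Ω`, or the superlevel set `{|v| ≥ |v x|/2}` measured by Chebyshev, and integrating in `x`,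
gives the Poincaré and the Gagliardo-Nirenberg inequality. The latter upgrades an `L^p` bound to an
`L^{2+2sp/N}` bound.

If `2s < N`, the exponent `2^*_s` is the fixed point of `p ↦ 2 + 2sp/N`; absorbing one factor gives
the Sobolev inequality, and `p = 2^*_s` gives (a). If `2s ≥ N`, then `N = 1` and the map increases
every exponent by at least 2, so one embedding yields all larger exponents; `p = 2q` makes the power
of `λ` equal to 1, which is (b). The starting embedding is Poincaré when `|Ω| < ∞`, whose constant
sees only `|Ω|`, and the assumed compact embedding otherwise. -/

/-- The integrand of the energy, as a function on the product space. -/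
noncomputable def energyDensity {N : ℕ} (s : ℝ) (u : Space N → ℝ) (z : Space N × Space N) : ℝ≥0∞ :=
  ENNReal.ofReal ((u z.1 - u z.2) ^ 2 / ‖z.1 - z.2‖ ^ ((N : ℝ) + 2 * s))

variable {N : ℕ} {s : ℝ} {u v w : Space N → ℝ}

theorem measurable_energyDensity (hu : Measurable u) : Measurable (energyDensity s u) := by
  unfold energyDensity
  fun_prop

theorem energy_eq_lintegral_prod (hu : Measurable u) :
    energy s u = ∫⁻ z, energyDensity s u z ∂(volume.prod volume) := by
  rw [lintegral_prod _ (measurable_energyDensity hu).aemeasurable]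
  rfl

theorem energy_congr (h : u =ᵐ[volume] v) : energy s u = energy s v := by
  unfold energy
  refine lintegral_congr_ae ?_
  filter_upwards [h] with x hx
  refine lintegral_congr_ae ?_
  filter_upwards [h] with y hy
  rw [hx, hy]

theorem energyForm_congr {φ ψ : Space N → ℝ} (h : u =ᵐ[volume] v) (h' : φ =ᵐ[volume] ψ) :
    energyForm s u φ = energyForm s v ψ := by
  unfold energyForm
  refine integral_congr_ae ?_
  filter_upwards [h, h'] with x hx hx'
  refine integral_congr_ae ?_
  filter_upwards [h, h'] with y hy hy'
  rw [hx, hy, hx', hy']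

theorem energyDensity_smul (c : ℝ) (z : Space N × Space N) :
    energyDensity s (c • u) z = ENNReal.ofReal (c ^ 2) * energyDensity s u z := by
  unfold energyDensity
  rw [← ENNReal.ofReal_mul (sq_nonneg c)]
  congr 1
  simp only [Pi.smul_apply, smul_eq_mul]
  ring

theorem energy_smul (c : ℝ) (hu : Measurable u) :
    energy s (c • u) = ENNReal.ofReal (c ^ 2) * energy s u := by
  rw [energy_eq_lintegral_prod hu, energy_eq_lintegral_prod (hu.const_smul c),
    ← lintegral_const_mul _ (measurable_energyDensity hu)]
  simp only [energyDensity_smul]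

theorem energyDensity_add_le (z : Space N × Space N) :
    energyDensity s (u + v) z ≤ 2 * energyDensity s u z + 2 * energyDensity s v z := by
  unfold energyDensity
  have h2 : ∀ a : ℝ, (2 : ℝ≥0∞) * ENNReal.ofReal a = ENNReal.ofReal (2 * a) := fun a => by
    rw [ENNReal.ofReal_mul zero_le_two, ENNReal.ofReal_ofNat]
  rw [h2, h2, ← ENNReal.ofReal_add (by positivity) (by positivity)]
  refine ENNReal.ofReal_le_ofReal ?_
  rw [← mul_div_assoc, ← mul_div_assoc, ← add_div]
  refine div_le_div_of_nonneg_right ?_ (by positivity)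
  simp only [Pi.add_apply]
  nlinarith [sq_nonneg ((u z.1 - u z.2) - (v z.1 - v z.2))]

theorem energy_add_le (hu : Measurable u) (hv : Measurable v) :
    energy s (u + v) ≤ 2 * energy s u + 2 * energy s v := by
  rw [energy_eq_lintegral_prod hu, energy_eq_lintegral_prod hv,
    energy_eq_lintegral_prod (hu.add hv), ← lintegral_const_mul _ (measurable_energyDensity hu),
    ← lintegral_const_mul _ (measurable_energyDensity hv),
    ← lintegral_add_left ((measurable_energyDensity hu).const_mul 2)]
  exact lintegral_mono energyDensity_add_le

theorem energyDensity_neg (z : Space N × Space N) :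
    energyDensity s (-u) z = energyDensity s u z := by
  unfold energyDensity
  simp only [Pi.neg_apply]
  congr 2
  ring

theorem energy_neg : energy s (-u) = energy s u :=
  lintegral_congr fun x => lintegral_congr fun y => energyDensity_neg (x, y)

theorem energy_sub_comm : energy s (u - v) = energy s (v - u) := by
  rw [← neg_sub, energy_neg]

theorem energy_sub_le (hu : Measurable u) (hv : Measurable v) (hw : Measurable w) :
    energy s (u - w) ≤ 2 * energy s (u - v) + 2 * energy s (v - w) := by
  have := energy_add_le (s := s) (hu.sub hv) (hv.sub hw)
  rwa [sub_add_sub_cancel] at this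

theorem IsTestFunction.measurable {Ω : Set (Space N)} (h : IsTestFunction Ω u) : Measurable u :=
  h.1.continuous.measurable

/-- The radial kernel that dominates the energy density of a bounded Lipschitz function is
integrable. -/
theorem lintegral_truncated_kernel_lt_top (hN : 1 ≤ N) (hs0 : 0 < s) (hs1 : s < 1) :
    ∫⁻ z : Space N, ENNReal.ofReal (min (‖z‖ ^ 2) 1 / ‖z‖ ^ ((N : ℝ) + 2 * s)) < ⊤ := by
  have : Nonempty (Fin N) := ⟨⟨0, hN⟩⟩
  have : Nontrivial (Space N) := inferInstance
  have key : Integrable (fun z : Space N => min (‖z‖ ^ 2) 1 / ‖z‖ ^ ((N : ℝ) + 2 * s)) := by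
    refine (integrable_fun_norm_addHaar volume
      (f := fun r : ℝ => min (r ^ 2) 1 / r ^ ((N : ℝ) + 2 * s))).2 ?_
    rw [finrank_euclideanSpace_fin]
    have hpow : ∀ y : ℝ, 0 < y → y ^ (N - 1) = y ^ ((N : ℝ) - 1) := fun y hy => by
      rw [← Real.rpow_natCast, Nat.cast_sub hN, Nat.cast_one]
    rw [← Ioc_union_Ioi_eq_Ioi (zero_le_one' ℝ)]
    refine IntegrableOn.union ?_ ?_
    -- In polar coordinates the integrand is `r^{1-2s}` near 0, integrable because `s < 1`, and
    -- `r^{-1-2s}` at infinity, integrable because `s > 0`.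
    · have h1 : IntegrableOn (fun y : ℝ => y ^ (1 - 2 * s)) (Ioc 0 1) :=
        (intervalIntegral.intervalIntegrable_rpow' (by linarith)).1
      refine h1.congr_fun (fun y hy => ?_) measurableSet_Ioc
      have hy0 : 0 < y := hy.1
      have : min (y ^ 2) 1 = y ^ (2 : ℝ) := by
        rw [min_eq_left (by nlinarith [hy.1, hy.2]), Real.rpow_two]
      simp only [smul_eq_mul]
      rw [this, hpow y hy0, ← Real.rpow_sub hy0, ← Real.rpow_add hy0]
      congr 1
      ring
    · have h1 : IntegrableOn (fun y : ℝ => y ^ (-1 - 2 * s)) (Ioi 1) :=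
        integrableOn_Ioi_rpow_of_lt (by linarith) one_pos
      refine h1.congr_fun (fun y hy => ?_) measurableSet_Ioi
      have hy1 : 1 < y := hy
      have hy0 : 0 < y := by linarith
      have : min (y ^ 2) 1 = 1 := min_eq_right (by nlinarith)
      simp only [smul_eq_mul]
      rw [this, hpow y hy0, one_div, ← Real.rpow_neg hy0.le, ← Real.rpow_add hy0]
      congr 1
      ring
  have := key.lintegral_lt_top
  exact this

/-- A function whose energy density is dominated by an integrable convolution kernel, and which
vanishes off a set of finite measure, has finite energy. -/
theorem energy_lt_top_of_density_le {K : Set (Space N)} (hKm : MeasurableSet K)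
    (hK : volume K < ⊤) (hu : Measurable u) (hu0 : ∀ x ∉ K, u x = 0) {g : Space N → ℝ≥0∞}
    (hgm : Measurable g) (hgI : ∫⁻ z, g z < ⊤)
    (h : ∀ x y, energyDensity s u (x, y) ≤ g (x - y)) : energy s u < ⊤ := by
  -- A pair contributes only if one of its two points lies in `K`.
  have hpt : ∀ z : Space N × Space N, energyDensity s u z ≤
      K.indicator 1 z.1 * g (z.1 - z.2) + K.indicator 1 z.2 * g (z.1 - z.2) := by
    rintro ⟨x, y⟩
    by_cases hx : x ∈ K
    · simp only [indicator_of_mem hx, Pi.one_apply, one_mul]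
      exact (h x y).trans le_self_add
    by_cases hy : y ∈ K
    · simp only [indicator_of_mem hy, Pi.one_apply, one_mul]
      exact (h x y).trans le_add_self
    · simp [energyDensity, hu0 x hx, hu0 y hy]
  have hind : Measurable (K.indicator (1 : Space N → ℝ≥0∞)) := measurable_one.indicator hKm
  have hm1 : Measurable fun z : Space N × Space N => K.indicator 1 z.1 * g (z.1 - z.2) :=
    (hind.comp measurable_fst).mul (hgm.comp (measurable_fst.sub measurable_snd))
  have hm2 : Measurable fun z : Space N × Space N => K.indicator 1 z.2 * g (z.1 - z.2) :=
    (hind.comp measurable_snd).mul (hgm.comp (measurable_fst.sub measurable_snd))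
  have hfin : (∫⁻ x : Space N, K.indicator 1 x) * (∫⁻ z, g z) < ⊤ := by
    rw [lintegral_indicator_one hKm]
    exact ENNReal.mul_lt_top hK hgI
  rw [energy_eq_lintegral_prod hu]
  refine (lintegral_mono hpt).trans_lt ?_
  rw [lintegral_add_left hm1, lintegral_prod _ hm1.aemeasurable,
    lintegral_prod_symm _ hm2.aemeasurable]
  refine ENNReal.add_lt_top.2 ⟨lt_of_eq_of_lt ?_ hfin, lt_of_eq_of_lt ?_ hfin⟩
  · rw [← lintegral_mul_const _ hind]
    refine lintegral_congr fun x => ?_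
    simp only
    rw [lintegral_const_mul (f := fun y => g (x - y)) _ (by fun_prop),
      lintegral_sub_left_eq_self]
  · rw [← lintegral_mul_const _ hind]
    refine lintegral_congr fun x => ?_
    simp only
    rw [lintegral_const_mul (f := fun y => g (y - x)) _ (by fun_prop),
      lintegral_sub_right_eq_self]

theorem IsTestFunction.energy_lt_top (hN : 1 ≤ N) (hs0 : 0 < s) (hs1 : s < 1)
    {Ω : Set (Space N)} (h : IsTestFunction Ω u) : energy s u < ⊤ := by
  obtain ⟨L, hL⟩ := ContDiff.lipschitzWith_of_hasCompactSupport h.2.1 h.1 (by simp)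
  obtain ⟨M, hM⟩ := h.2.1.exists_bound_of_continuous h.1.continuous
  have hA0 : (0 : ℝ) ≤ (L : ℝ) ^ 2 + 4 * M ^ 2 := by positivity
  have hgm : Measurable fun z : Space N =>
      ENNReal.ofReal (min (‖z‖ ^ 2) 1 / ‖z‖ ^ ((N : ℝ) + 2 * s)) := by fun_prop
  refine energy_lt_top_of_density_le (K := tsupport u) h.2.1.isCompact.measurableSet
    h.2.1.isCompact.measure_lt_top h.measurable (fun x hx => image_eq_zero_of_notMem_tsupport hx)
    (hgm.const_mul (ENNReal.ofReal ((L : ℝ) ^ 2 + 4 * M ^ 2))) ?_ fun x y => ?_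
  · rw [lintegral_const_mul _ hgm]
    exact ENNReal.mul_lt_top ENNReal.ofReal_lt_top (lintegral_truncated_kernel_lt_top hN hs0 hs1)
  rw [← ENNReal.ofReal_mul hA0, ← mul_div_assoc]
  refine ENNReal.ofReal_le_ofReal (div_le_div_of_nonneg_right ?_ (by positivity))
  have h1 : |u x - u y| ≤ L * ‖x - y‖ := by
    simpa [Real.dist_eq, dist_eq_norm] using hL.dist_le_mul x y
  have h2 : |u x - u y| ≤ 2 * M := by
    have hx := hM x
    have hy := hM y
    rw [Real.norm_eq_abs] at hx hy
    linarith [abs_sub (u x) (u y)]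
  have h3 : (u x - u y) ^ 2 ≤ (L : ℝ) ^ 2 * ‖x - y‖ ^ 2 := by
    rw [← sq_abs, ← mul_pow]
    exact pow_le_pow_left₀ (abs_nonneg _) h1 2
  have h4 : (u x - u y) ^ 2 ≤ 4 * M ^ 2 := by
    rw [← sq_abs]
    linarith [pow_le_pow_left₀ (abs_nonneg _) h2 2, mul_pow 2 M 2]
  change (u x - u y) ^ 2 ≤ _
  rcases le_total (‖x - y‖ ^ 2) 1 with h5 | h5
  · rw [min_eq_left h5, add_mul]
    linarith [mul_nonneg (sq_nonneg (2 * M)) (sq_nonneg ‖x - y‖), mul_pow 2 M 2]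
  · rw [min_eq_right h5]
    linarith [sq_nonneg (L : ℝ)]

end FracSemilinear

/-! ### The energy space and its stability under smooth contractions. -/

namespace FracSemilinear

variable {N : ℕ} {s : ℝ} {u v w : Space N → ℝ} {Ω : Set (Space N)}

theorem ae_prod_of_ae {p : Space N → Prop} (h : ∀ᵐ x, p x) :
    ∀ᵐ z : Space N × Space N ∂(volume.prod volume), p z.1 ∧ p z.2 :=
  (Measure.quasiMeasurePreserving_fst.ae h).and (Measure.quasiMeasurePreserving_snd.ae h)

theorem tendsto_energyDensity {ι : Type*} {l : Filter ι} {φ : ι → Space N → ℝ}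
    {z : Space N × Space N} (h1 : Tendsto (fun n => φ n z.1) l (𝓝 (u z.1)))
    (h2 : Tendsto (fun n => φ n z.2) l (𝓝 (u z.2))) :
    Tendsto (fun n => energyDensity s (φ n) z) l (𝓝 (energyDensity s u z)) :=
  (ENNReal.continuous_ofReal.tendsto _).comp (((h1.sub h2).pow 2).div_const _)

/-- Fatou's lemma on the product space. -/
theorem energy_le_liminf {φ : ℕ → Space N → ℝ} (hφ : ∀ n, Measurable (φ n)) (hu : Measurable u)
    (h : ∀ᵐ x, Tendsto (fun n => φ n x) atTop (𝓝 (u x))) :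
    energy s u ≤ liminf (fun n => energy s (φ n)) atTop := by
  simp only [energy_eq_lintegral_prod, hφ, hu]
  refine le_trans (le_of_eq ?_)
    (lintegral_liminf_le fun n => measurable_energyDensity (s := s) (hφ n))
  refine lintegral_congr_ae ?_
  filter_upwards [ae_prod_of_ae h] with z hz
  exact (tendsto_energyDensity hz.1 hz.2).liminf_eq.symm

/-- Lower semicontinuity, applied to `φ n - φ m` as `m → ∞` with `n` fixed, turns the Cauchy
property into convergence to the pointwise limit. -/
theorem tendsto_energy_sub {φ : ℕ → Space N → ℝ} (hφ : ∀ n, Measurable (φ n)) (hu : Measurable u)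
    (hc : Tendsto (fun p : ℕ × ℕ => energy s (φ p.1 - φ p.2)) atTop (𝓝 0))
    (h : ∀ᵐ x, Tendsto (fun n => φ n x) atTop (𝓝 (u x))) :
    Tendsto (fun n => energy s (φ n - u)) atTop (𝓝 0) := by
  rw [ENNReal.tendsto_nhds_zero] at hc ⊢
  intro ε hε
  obtain ⟨⟨a, b⟩, hab⟩ := eventually_atTop.1 (hc ε hε)
  filter_upwards [eventually_ge_atTop a] with n hn
  refine (energy_le_liminf (φ := fun m => φ n - φ m) (fun m => (hφ n).sub (hφ m))
    ((hφ n).sub hu) ?_).trans ?_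
  · filter_upwards [h] with x hx
    exact tendsto_const_nhds.sub hx
  · refine liminf_le_of_frequently_le' ?_
    refine Eventually.frequently ?_
    filter_upwards [eventually_ge_atTop b] with m hm
    exact hab (n, m) ⟨hn, hm⟩

theorem tendsto_energy_sub_of_tendsto {φ : ℕ → Space N → ℝ} (hφ : ∀ n, Measurable (φ n))
    (hu : Measurable u) (h : Tendsto (fun n => energy s (φ n - u)) atTop (𝓝 0)) :
    Tendsto (fun p : ℕ × ℕ => energy s (φ p.1 - φ p.2)) atTop (𝓝 0) := by
  have h1 : Tendsto (fun p : ℕ × ℕ => 2 * energy s (φ p.1 - u) + 2 * energy s (φ p.2 - u))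
      atTop (𝓝 0) := by
    rw [← prod_atTop_atTop_eq]
    have := (ENNReal.Tendsto.const_mul (a := 2) (h.comp tendsto_fst)
      (Or.inr ENNReal.ofNat_ne_top)).add (ENNReal.Tendsto.const_mul (a := 2) (h.comp tendsto_snd)
      (Or.inr ENNReal.ofNat_ne_top))
    simpa using this
  refine tendsto_of_tendsto_of_tendsto_of_le_of_le tendsto_const_nhds h1 (fun _ => zero_le) ?_
  intro p
  have := energy_sub_le (s := s) (hφ p.1) hu (hφ p.2)
  rwa [energy_sub_comm (u := u)] at this

theorem D0.congr (hu : u ∈ D0 Ω s) (h : u =ᵐ[volume] v) : v ∈ D0 Ω s := by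
  obtain ⟨φ, h1, h2, h3⟩ := hu
  refine ⟨φ, h1, h2, ?_⟩
  filter_upwards [h3, h] with x hx hx'
  rwa [← hx']

theorem D0.aemeasurable (hu : u ∈ D0 Ω s) : AEMeasurable u := by
  obtain ⟨φ, h1, h2, h3⟩ := hu
  exact aemeasurable_of_tendsto_metrizable_ae _ (fun n => (h1 n).measurable.aemeasurable) h3

theorem D0.ae_eq_zero (hu : u ∈ D0 Ω s) : ∀ᵐ x, x ∉ Ω → u x = 0 := by
  obtain ⟨φ, h1, h2, h3⟩ := hu
  filter_upwards [h3] with x hx hxΩ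
  have : ∀ n, φ n x = 0 := fun n =>
    image_eq_zero_of_notMem_tsupport fun hmem => hxΩ ((h1 n).2.2 hmem)
  simp only [this] at hx
  exact (tendsto_nhds_unique tendsto_const_nhds hx).symm

theorem IsTestFunction.const_smul (hu : IsTestFunction Ω u) (c : ℝ) : IsTestFunction Ω (c • u) :=
  ⟨contDiff_const.smul hu.1, hu.2.1.smul_left (f := fun _ => c),
    (closure_mono (Function.support_const_smul_subset c u)).trans hu.2.2⟩

theorem D0.const_smul (hu : u ∈ D0 Ω s) (c : ℝ) : c • u ∈ D0 Ω s := by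
  obtain ⟨φ, h1, h2, h3⟩ := hu
  refine ⟨fun n => c • φ n, fun n => (h1 n).const_smul c, ?_, ?_⟩
  · simp only [← smul_sub]
    simp only [energy_smul, (h1 _).measurable.sub (h1 _).measurable]
    simpa using ENNReal.Tendsto.const_mul h2 (Or.inr (ENNReal.ofReal_ne_top (r := c ^ 2)))
  · filter_upwards [h3] with x hx
    exact hx.const_smul c

theorem D0.neg (hu : u ∈ D0 Ω s) : -u ∈ D0 Ω s := by
  simpa using D0.const_smul hu (-1)

theorem D0.exists_approx (hu : u ∈ D0 Ω s) (hum : Measurable u) :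
    ∃ φ : ℕ → Space N → ℝ, (∀ n, IsTestFunction Ω (φ n)) ∧
      Tendsto (fun n => energy s (φ n - u)) atTop (𝓝 0) ∧
      ∀ᵐ x, Tendsto (fun n => φ n x) atTop (𝓝 (u x)) := by
  obtain ⟨φ, h1, h2, h3⟩ := hu
  exact ⟨φ, h1, tendsto_energy_sub (fun n => (h1 n).measurable) hum h2 h3, h3⟩

theorem D0.energy_lt_top (hN : 1 ≤ N) (hs0 : 0 < s) (hs1 : s < 1) (hu : u ∈ D0 Ω s) :
    energy s u < ⊤ := by
  obtain ⟨u', hu', hae⟩ := D0.aemeasurable hu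
  rw [energy_congr hae]
  obtain ⟨φ, h1, h2, -⟩ := D0.exists_approx (D0.congr hu hae) hu'
  obtain ⟨n, hn⟩ := ((ENNReal.tendsto_nhds_zero.1 h2) 1 one_pos).exists
  have h3 := energy_add_le (s := s) (h1 n).measurable ((hu'.sub (h1 n).measurable))
  rw [add_sub_cancel, energy_sub_comm (u := u')] at h3
  refine h3.trans_lt (ENNReal.add_lt_top.2 ⟨ENNReal.mul_lt_top (by simp)
    ((h1 n).energy_lt_top hN hs0 hs1), ENNReal.mul_lt_top (by simp) (hn.trans_lt (by simp))⟩)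

theorem energyDensity_comp_sub_le {G : ℝ → ℝ} (hG : LipschitzWith 1 G) (z : Space N × Space N) :
    energyDensity s (G ∘ v - G ∘ u) z ≤ 2 * energyDensity s (v - u) z + 8 * energyDensity s u z := by
  have h2 : ∀ (n : ℕ) (a : ℝ), (n : ℝ≥0∞) * ENNReal.ofReal a = ENNReal.ofReal (n * a) :=
    fun n a => by rw [ENNReal.ofReal_mul n.cast_nonneg, ENNReal.ofReal_natCast]
  have h2a := h2 2
  have h2b := h2 8
  push_cast at h2a h2b
  unfold energyDensity
  rw [h2a, h2b, ← ENNReal.ofReal_add (by positivity) (by positivity)]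
  refine ENNReal.ofReal_le_ofReal ?_
  rw [← mul_div_assoc, ← mul_div_assoc, ← add_div]
  refine div_le_div_of_nonneg_right ?_ (by positivity)
  simp only [Pi.sub_apply, Function.comp_apply]
  have hl : ∀ a b, |G a - G b| ≤ |a - b| := fun a b => by
    simpa [Real.dist_eq] using hG.dist_le_mul a b
  set a := (v z.1 - u z.1) - (v z.2 - u z.2) with ha
  set b := u z.1 - u z.2 with hb
  have e1 : |G (v z.1) - G (v z.2)| ≤ |a| + |b| := by
    refine (hl _ _).trans ?_
    have : v z.1 - v z.2 = a + b := by rw [ha, hb]; ring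
    rw [this]
    exact abs_add_le a b
  have e2 : |G (u z.1) - G (u z.2)| ≤ |b| := hl _ _
  have e3 : |G (v z.1) - G (u z.1) - (G (v z.2) - G (u z.2))| ≤ |a| + 2 * |b| := by
    have : G (v z.1) - G (u z.1) - (G (v z.2) - G (u z.2)) =
      (G (v z.1) - G (v z.2)) - (G (u z.1) - G (u z.2)) := by ring
    rw [this]
    linarith [abs_sub (G (v z.1) - G (v z.2)) (G (u z.1) - G (u z.2))]
  calc _ ≤ (|a| + 2 * |b|) ^ 2 := by
        rw [← sq_abs]
        exact pow_le_pow_left₀ (abs_nonneg _) e3 2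
    _ ≤ 2 * a ^ 2 + 8 * b ^ 2 := by
        rw [← sq_abs a, ← sq_abs b]
        linarith [sq_nonneg (|a| - 2 * |b|)]

/-- Composition with `G` need not be Lipschitz for the energy norm, so dominated convergence is
needed. The density of `G ∘ φ n - G ∘ u` is at most twice that of `φ n - u`, whose integral tends to
0, plus its own truncation at the fixed integrable function `8 * energyDensity s u`; the truncated
part tends to 0 pointwise. -/
theorem tendsto_energy_comp_sub {G : ℝ → ℝ} (hG : LipschitzWith 1 G) {φ : ℕ → Space N → ℝ}
    (hφ : ∀ n, Measurable (φ n)) (hu : Measurable u) (huE : energy s u ≠ ⊤)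
    (hE : Tendsto (fun n => energy s (φ n - u)) atTop (𝓝 0))
    (h : ∀ᵐ x, Tendsto (fun n => φ n x) atTop (𝓝 (u x))) :
    Tendsto (fun n => energy s (G ∘ φ n - G ∘ u)) atTop (𝓝 0) := by
  have hGm : Measurable G := hG.continuous.measurable
  have hm : ∀ n, Measurable (G ∘ φ n - G ∘ u) := fun n => (hGm.comp (hφ n)).sub (hGm.comp hu)
  set F : ℕ → Space N × Space N → ℝ≥0∞ := fun n z =>
    min (energyDensity s (G ∘ φ n - G ∘ u) z) (8 * energyDensity s u z) with hF
  have hFm : ∀ n, Measurable (F n) := fun n =>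
    (measurable_energyDensity (hm n)).min ((measurable_energyDensity hu).const_mul 8)
  have hlim : Tendsto (fun n => ∫⁻ z, F n z ∂(volume.prod volume)) atTop (𝓝 0) := by
    have := tendsto_lintegral_of_dominated_convergence' (μ := volume.prod volume) (F := F)
      (f := fun _ => 0) (fun z => 8 * energyDensity s u z) (fun n => (hFm n).aemeasurable)
      (fun n => ae_of_all _ fun z => min_le_right _ _) ?_ ?_
    · simpa using this
    · rw [lintegral_const_mul _ (measurable_energyDensity hu), ← energy_eq_lintegral_prod hu]
      exact ENNReal.mul_ne_top (by simp) huE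
    · filter_upwards [ae_prod_of_ae h] with z hz
      have h0 : Tendsto (fun n => energyDensity s (G ∘ φ n - G ∘ u) z) atTop
          (𝓝 (energyDensity s (0 : Space N → ℝ) z)) := by
        refine tendsto_energyDensity ?_ ?_
        · simpa using (((hG.continuous.tendsto _).comp hz.1).sub_const (G (u z.1)))
        · simpa using (((hG.continuous.tendsto _).comp hz.2).sub_const (G (u z.2)))
      have h1 : energyDensity s (0 : Space N → ℝ) z = 0 := by simp [energyDensity]
      rw [h1] at h0
      exact tendsto_of_tendsto_of_tendsto_of_le_of_le tendsto_const_nhds h0 (fun _ => zero_le)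
        (fun n => min_le_left _ _)
  have hsum : Tendsto (fun n => 2 * energy s (φ n - u) + ∫⁻ z, F n z ∂(volume.prod volume))
      atTop (𝓝 0) := by
    simpa using (ENNReal.Tendsto.const_mul (a := 2) hE (Or.inr ENNReal.ofNat_ne_top)).add hlim
  refine tendsto_of_tendsto_of_tendsto_of_le_of_le tendsto_const_nhds hsum (fun _ => zero_le) ?_
  intro n
  simp only
  rw [energy_eq_lintegral_prod (hm n), energy_eq_lintegral_prod ((hφ n).sub hu),
    ← lintegral_const_mul _ (measurable_energyDensity ((hφ n).sub hu)),
    ← lintegral_add_right _ (hFm n)]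
  refine lintegral_mono fun z => ?_
  rcases le_total (energyDensity s (G ∘ φ n - G ∘ u) z) (8 * energyDensity s u z) with h1 | h1
  · simp only [hF, min_eq_left h1]
    exact le_add_self
  · simp only [hF, min_eq_right h1]
    exact energyDensity_comp_sub_le hG z

theorem IsTestFunction.comp {G : ℝ → ℝ} (hG : ContDiff ℝ ∞ G) (hG0 : G 0 = 0)
    (hu : IsTestFunction Ω u) : IsTestFunction Ω (G ∘ u) :=
  ⟨hG.comp hu.1, hu.2.1.comp_left hG0,
    (closure_mono (Function.support_comp_subset hG0 u)).trans hu.2.2⟩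

/-- A smooth `G` with `G 0 = 0` maps test functions to test functions, so `G ∘ φ n` is an admissible
approximating sequence. A kinked truncation would need a further mollification; hence the smooth
truncations used below. -/
theorem D0.comp (hN : 1 ≤ N) (hs0 : 0 < s) (hs1 : s < 1) {G : ℝ → ℝ} (hG : ContDiff ℝ ∞ G)
    (hG0 : G 0 = 0) (hGL : LipschitzWith 1 G) (hum : Measurable u) (hu : u ∈ D0 Ω s) :
    G ∘ u ∈ D0 Ω s := by
  obtain ⟨φ, h1, h2, h3⟩ := D0.exists_approx hu hum
  have hE := D0.energy_lt_top hN hs0 hs1 hu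
  have hlim := tendsto_energy_comp_sub hGL (fun n => (h1 n).measurable) hum hE.ne h2 h3
  have hT : ∀ n, IsTestFunction Ω (G ∘ φ n) := fun n => (h1 n).comp hG hG0
  have hc := tendsto_energy_sub_of_tendsto (φ := fun n => G ∘ φ n) (fun n => (hT n).measurable)
    (hG.continuous.measurable.comp hum) hlim
  refine ⟨fun n => G ∘ φ n, hT, hc, ?_⟩
  filter_upwards [h3] with x hx
  exact (hG.continuous.tendsto _).comp hx

end FracSemilinear

/-! ### Poincaré and Gagliardo-Nirenberg inequalities from a fibrewise lower bound. -/

namespace FracSemilinear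

variable {N : ℕ} {s : ℝ} {u v w : Space N → ℝ} {Ω : Set (Space N)}

/-- The volume of the unit ball. -/
noncomputable def unitBallVolume (N : ℕ) : ℝ := (volume (Metric.ball (0 : Space N) 1)).toReal

theorem unitBallVolume_pos (N : ℕ) : 0 < unitBallVolume N :=
  ENNReal.toReal_pos (Metric.measure_ball_pos _ _ one_pos).ne' measure_ball_lt_top.ne

/-- If `v` differs from `v x` by at least `τ` off a set of measure at most `a`, then the fibre of the
energy at `x` is bounded from below. -/
theorem le_lintegral_energyDensity (hN : 1 ≤ N) (hs0 : 0 < s) {x : Space N} {T : Set (Space N)}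
    (hT : MeasurableSet T) {a τ : ℝ} (ha : 0 < a) (hTa : volume T ≤ ENNReal.ofReal a) (hτ : 0 < τ)
    (h : ∀ᵐ y, y ∉ T → τ ≤ |v x - v y|) :
    ENNReal.ofReal (τ ^ 2 * a / (2 * a / unitBallVolume N) ^ (1 + 2 * s / N)) ≤
      ∫⁻ y, energyDensity s v (x, y) := by
  have : Nonempty (Fin N) := ⟨⟨0, hN⟩⟩
  have : Nontrivial (Space N) := inferInstance
  have hω := unitBallVolume_pos N
  have hN0 : (0 : ℝ) < N := by exact_mod_cast hN
  set b := 2 * a / unitBallVolume N with hb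
  have hb0 : 0 < b := by positivity
  -- The ball of radius `r` has measure `2a`, so removing `T` leaves measure at least `a`.
  set r := b ^ (1 / (N : ℝ)) with hr
  have hr0 : 0 < r := by positivity
  have hrN : r ^ N = b := by
    rw [hr, one_div, Real.rpow_inv_natCast_pow hb0.le (by omega)]
  have hball : volume (Metric.ball x r) = ENNReal.ofReal (2 * a) := by
    rw [Measure.addHaar_ball _ _ hr0.le, finrank_euclideanSpace_fin, hrN,
      ← ENNReal.ofReal_toReal (measure_ball_lt_top (x := (0 : Space N)) (r := 1)).ne,
      ← ENNReal.ofReal_mul hb0.le]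
    congr 1
    change b * unitBallVolume N = 2 * a
    rw [hb]
    field_simp
  have hdiff : ENNReal.ofReal a ≤ volume (Metric.ball x r \ T) := by
    refine le_trans ?_ le_measure_sdiff
    rw [hball]
    have h2 : ENNReal.ofReal (2 * a) = ENNReal.ofReal a + ENNReal.ofReal a := by
      rw [← ENNReal.ofReal_add ha.le ha.le, two_mul]
    rw [h2]
    refine ENNReal.le_sub_of_add_le_right (hTa.trans_lt ENNReal.ofReal_lt_top).ne ?_
    gcongr
  have hpow : r ^ ((N : ℝ) + 2 * s) = b ^ (1 + 2 * s / N) := by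
    rw [hr, ← Real.rpow_mul hb0.le]
    congr 1
    field_simp
  calc ENNReal.ofReal (τ ^ 2 * a / b ^ (1 + 2 * s / N))
      = ENNReal.ofReal (τ ^ 2 / r ^ ((N : ℝ) + 2 * s)) * ENNReal.ofReal a := by
        rw [← ENNReal.ofReal_mul (by positivity), hpow]
        congr 1
        ring
    _ ≤ ENNReal.ofReal (τ ^ 2 / r ^ ((N : ℝ) + 2 * s)) * volume (Metric.ball x r \ T) := by gcongr
    _ = ∫⁻ _ in Metric.ball x r \ T, ENNReal.ofReal (τ ^ 2 / r ^ ((N : ℝ) + 2 * s)) := by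
        rw [setLIntegral_const]
    _ ≤ ∫⁻ y in Metric.ball x r \ T, energyDensity s v (x, y) := by
        refine setLIntegral_mono_ae' (Metric.isOpen_ball.measurableSet.diff hT) ?_
        filter_upwards [h] with y hy hyT
        have hτy := hy hyT.2
        -- On the diagonal the density is `0 / 0 = 0`, so the lower bound needs `x ≠ y`.
        have hne : x ≠ y := by
          rintro rfl
          rw [sub_self, abs_zero] at hτy
          linarith
        have hdist : ‖x - y‖ ≤ r := by
          rw [← dist_eq_norm, dist_comm]
          exact (Metric.mem_ball.1 hyT.1).le
        have hpos : 0 < ‖x - y‖ := norm_pos_iff.2 (sub_ne_zero.2 hne)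
        refine ENNReal.ofReal_le_ofReal ?_
        refine div_le_div₀ (sq_nonneg _) ?_ (by positivity) ?_
        · rw [← sq_abs (v x - v y)]
          exact pow_le_pow_left₀ hτ.le hτy 2
        · exact Real.rpow_le_rpow hpos.le hdist (by positivity)
    _ ≤ ∫⁻ y, energyDensity s v (x, y) := setLIntegral_le_lintegral _ _

theorem energy_eq_iterated : energy s v = ∫⁻ x, ∫⁻ y, energyDensity s v (x, y) := rfl

theorem measurable_lintegral_energyDensity (hv : Measurable v) :
    Measurable fun x => ∫⁻ y, energyDensity s v (x, y) :=
  (measurable_energyDensity hv).lintegral_prod_right'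

/-- The Poincaré inequality on sets of finite measure. -/
theorem exists_lintegral_sq_le_energy (hN : 1 ≤ N) (hs0 : 0 < s) (m : ℝ≥0∞) (hm : m ≠ ⊤) :
    ∃ C : ℝ≥0∞, C ≠ ⊤ ∧ ∀ Ω : Set (Space N), MeasurableSet Ω → volume Ω = m →
      ∀ v : Space N → ℝ, Measurable v → (∀ᵐ x, x ∉ Ω → v x = 0) →
      ∫⁻ x, ENNReal.ofReal |v x| ^ (2 : ℝ) ≤ C * energy s v := by
  -- The summand 1 keeps `a` positive when `m = 0`.
  set a := m.toReal + 1 with ha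
  have ha0 : 0 < a := by positivity
  have hma : m ≤ ENNReal.ofReal a := by
    rw [ENNReal.le_ofReal_iff_toReal_le hm ha0.le]
    linarith
  have hω := unitBallVolume_pos N
  set c := a / (2 * a / unitBallVolume N) ^ (1 + 2 * s / N) with hc
  have hc0 : 0 < c := by positivity
  refine ⟨ENNReal.ofReal c⁻¹, ENNReal.ofReal_ne_top, fun Ω hΩ hΩm v hv hv0 => ?_⟩
  rw [energy_eq_iterated, ← lintegral_const_mul _ (measurable_lintegral_energyDensity hv)]
  refine lintegral_mono fun x => ?_
  simp only
  rcases eq_or_ne (v x) 0 with hx | hx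
  · simp [hx]
  have hx0 : 0 < |v x| := abs_pos.2 hx
  have := le_lintegral_energyDensity (v := v) (x := x) hN hs0 hΩ ha0 (hΩm.le.trans hma) hx0 (by
    filter_upwards [hv0] with y hy hyΩ
    rw [hy hyΩ, sub_zero])
  calc ENNReal.ofReal |v x| ^ (2 : ℝ) = ENNReal.ofReal c⁻¹ * ENNReal.ofReal (|v x| ^ 2 * c) := by
        rw [← ENNReal.ofReal_mul (by positivity), ENNReal.ofReal_rpow_of_pos hx0, Real.rpow_two]
        congr 1
        field_simp
    _ ≤ _ := by
        rw [hc, ← mul_div_assoc]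
        gcongr

/-- The fractional Gagliardo-Nirenberg inequality. -/
theorem exists_gagliardo_nirenberg (hN : 1 ≤ N) (hs0 : 0 < s) {p : ℝ} (hp : 0 < p) :
    ∃ C : ℝ≥0∞, C ≠ ⊤ ∧ ∀ v : Space N → ℝ, Measurable v →
      ∫⁻ x, ENNReal.ofReal |v x| ^ p ≠ ⊤ →
      ∫⁻ x, ENNReal.ofReal |v x| ^ (2 + 2 * s * p / N) ≤
        C * energy s v * (∫⁻ x, ENNReal.ofReal |v x| ^ p) ^ (2 * s / N) := by
  have hω := unitBallVolume_pos N
  have hN0 : (0 : ℝ) < N := by exact_mod_cast hN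
  -- Chosen so that `hreal` below is an equality; the 4 comes from `(t / 2) ^ 2`.
  set κ : ℝ := 4 * (2 / unitBallVolume N) ^ (1 + 2 * s / N) * (2 ^ p) ^ (2 * s / N) with hκ
  have hκ0 : 0 < κ := by positivity
  refine ⟨ENNReal.ofReal κ, ENNReal.ofReal_ne_top, fun v hv hfin => ?_⟩
  set Ap := ∫⁻ x, ENNReal.ofReal |v x| ^ p with hAp
  have hmv : Measurable fun x => ENNReal.ofReal |v x| :=
    ENNReal.measurable_ofReal.comp hv.abs
  rcases eq_or_ne Ap 0 with h0 | h0
  · have hae : ∀ᵐ x, ENNReal.ofReal |v x| ^ (2 + 2 * s * p / N) = 0 := by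
      have := (lintegral_eq_zero_iff (hmv.pow_const p)).1 h0
      filter_upwards [this] with x hx
      have hx' : ENNReal.ofReal |v x| = 0 := (ENNReal.rpow_eq_zero_iff_of_pos hp).1 hx
      rw [hx', ENNReal.zero_rpow_of_pos (by positivity)]
    rw [lintegral_congr_ae hae]
    simp
  set A := Ap.toReal with hA
  have hA0 : 0 < A := ENNReal.toReal_pos h0 hfin
  have hApA : Ap = ENNReal.ofReal A := (ENNReal.ofReal_toReal hfin).symm
  rw [mul_right_comm (ENNReal.ofReal κ), energy_eq_iterated,
    ← lintegral_const_mul _ (measurable_lintegral_energyDensity hv)]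
  refine lintegral_mono fun x => ?_
  simp only
  rcases eq_or_ne (v x) 0 with hx | hx
  · rw [hx, abs_zero, ENNReal.ofReal_zero, ENNReal.zero_rpow_of_pos (by positivity)]
    exact zero_le
  set t := |v x| with ht
  have ht0 : 0 < t := abs_pos.2 hx
  -- This is `{|v| ≥ t/2}`, of measure at most `a` by Chebyshev; off it `v` differs from `v x` by at
  -- least `t/2`.
  set T : Set (Space N) := {y | ENNReal.ofReal (t / 2) ^ p ≤ ENNReal.ofReal |v y| ^ p} with hTdef
  have hTm : MeasurableSet T := measurableSet_le measurable_const (hmv.pow_const p)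
  set a := (2 / t) ^ p * A with ha
  have ha0 : 0 < a := by positivity
  have hTa : volume T ≤ ENNReal.ofReal a := by
    have h1 : ENNReal.ofReal (t / 2) ^ p * volume T ≤ Ap :=
      mul_meas_ge_le_lintegral (hmv.pow_const p) _
    rw [hApA, ENNReal.ofReal_rpow_of_pos (by positivity)] at h1
    calc volume T = ENNReal.ofReal ((2 / t) ^ p) *
          (ENNReal.ofReal ((t / 2) ^ p) * volume T) := by
          rw [← mul_assoc, ← ENNReal.ofReal_mul (by positivity), ← Real.mul_rpow (by positivity)
            (by positivity)]
          have : 2 / t * (t / 2) = 1 := by field_simp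
          rw [this, Real.one_rpow, ENNReal.ofReal_one, one_mul]
      _ ≤ ENNReal.ofReal ((2 / t) ^ p) * ENNReal.ofReal A := by
          gcongr
      _ = ENNReal.ofReal a := by rw [← ENNReal.ofReal_mul (by positivity)]
  have hlow := le_lintegral_energyDensity (v := v) (x := x) (s := s) hN hs0 hTm ha0 hTa
    (half_pos ht0) (by
      refine ae_of_all _ fun y hy => ?_
      have h1 : ENNReal.ofReal |v y| < ENNReal.ofReal (t / 2) := by
        by_contra hcon
        exact hy (ENNReal.rpow_le_rpow (not_lt.1 hcon) hp.le)
      have h2 : |v y| < t / 2 := (ENNReal.ofReal_lt_ofReal_iff (by positivity)).1 h1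
      linarith [abs_sub_abs_le_abs_sub (v x) (v y)])
  have hreal : t ^ (2 + 2 * s * p / N) ≤ κ * A ^ (2 * s / N) *
      ((t / 2) ^ 2 * a / (2 * a / unitBallVolume N) ^ (1 + 2 * s / N)) := by
    refine le_of_eq ?_
    have e1 : t ^ (2 + 2 * s * p / N) = t ^ 2 * (t ^ p) ^ (2 * s / N) := by
      rw [Real.rpow_add ht0, Real.rpow_two, ← Real.rpow_mul ht0.le]
      congr 2
      ring
    have e2 : (2 * a / unitBallVolume N) ^ (1 + 2 * s / N) =
        (2 / unitBallVolume N) ^ (1 + 2 * s / N) * (a * a ^ (2 * s / N)) := by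
      rw [mul_div_right_comm, Real.mul_rpow (by positivity) ha0.le, Real.rpow_add ha0,
        Real.rpow_one]
    have e3 : a ^ (2 * s / N) =
        (2 ^ p) ^ (2 * s / N) / (t ^ p) ^ (2 * s / N) * A ^ (2 * s / N) := by
      rw [ha, Real.mul_rpow (by positivity) hA0.le, Real.div_rpow zero_le_two ht0.le,
        Real.div_rpow (by positivity) (by positivity)]
    rw [e1, e2, e3, hκ]
    have p1 : 0 < (t ^ p) ^ (2 * s / N) := by positivity
    have p2 : 0 < ((2 : ℝ) ^ p) ^ (2 * s / N) := by positivity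
    have p3 : 0 < A ^ (2 * s / N) := by positivity
    have p4 : 0 < (2 / unitBallVolume N) ^ (1 + 2 * s / N) := by positivity
    field_simp
    ring
  calc ENNReal.ofReal t ^ (2 + 2 * s * p / N)
      = ENNReal.ofReal (t ^ (2 + 2 * s * p / N)) := ENNReal.ofReal_rpow_of_pos ht0
    _ ≤ _ := ENNReal.ofReal_le_ofReal hreal
    _ = ENNReal.ofReal κ * Ap ^ (2 * s / N) * ENNReal.ofReal
          ((t / 2) ^ 2 * a / (2 * a / unitBallVolume N) ^ (1 + 2 * s / N)) := by
        rw [hApA, ENNReal.ofReal_rpow_of_pos hA0, ← ENNReal.ofReal_mul hκ0.le,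
          ← ENNReal.ofReal_mul (by positivity)]
    _ ≤ _ := by gcongr

end FracSemilinear

/-! ### Embeddings of the energy space into Lebesgue spaces. -/

namespace FracSemilinear

variable {N : ℕ} {s : ℝ} {u v w : Space N → ℝ} {Ω : Set (Space N)}

/-- The `L^p` norm is controlled by the energy on the class `W`. -/
def Embeds {N : ℕ} (W : Set (Space N → ℝ)) (s p : ℝ) : Prop :=
  ∃ C : ℝ≥0∞, C ≠ ⊤ ∧ ∀ v ∈ W, ∫⁻ x, ENNReal.ofReal |v x| ^ p ≤ C * energy s v ^ (p / 2)

theorem measurable_ofReal_abs (hv : Measurable v) : Measurable fun x => ENNReal.ofReal |v x| :=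
  ENNReal.measurable_ofReal.comp hv.abs

/-- One step of the bootstrap for the exponent of an embedding. -/
theorem Embeds.gagliardo_nirenberg {W : Set (Space N → ℝ)} (hN : 1 ≤ N) (hs0 : 0 < s)
    (hW : ∀ v ∈ W, Measurable v ∧ energy s v < ⊤) {p : ℝ} (hp : 0 < p) (h : Embeds W s p) :
    Embeds W s (2 + 2 * s * p / N) := by
  obtain ⟨C, hC, hle⟩ := h
  obtain ⟨C', hC', hle'⟩ := exists_gagliardo_nirenberg (N := N) (s := s) hN hs0 hp
  have hN0 : (0 : ℝ) < N := by exact_mod_cast hN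
  have hsN : 0 ≤ 2 * s / N := by positivity
  refine ⟨C' * C ^ (2 * s / N), ENNReal.mul_ne_top hC' (ENNReal.rpow_ne_top_of_nonneg hsN hC),
    fun v hv => ?_⟩
  have hE := (hW v hv).2
  have hfin : ∫⁻ x, ENNReal.ofReal |v x| ^ p ≠ ⊤ := ((hle v hv).trans_lt (ENNReal.mul_lt_top
    hC.lt_top (ENNReal.rpow_lt_top_of_nonneg (by positivity) hE.ne))).ne
  refine (hle' v (hW v hv).1 hfin).trans ?_
  calc C' * energy s v * (∫⁻ x, ENNReal.ofReal |v x| ^ p) ^ (2 * s / N)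
      ≤ C' * energy s v * (C * energy s v ^ (p / 2)) ^ (2 * s / N) := by
        gcongr
        exact hle v hv
    _ = C' * C ^ (2 * s / N) * energy s v ^ ((2 + 2 * s * p / N) / 2) := by
        have : (2 + 2 * s * p / N) / 2 = 1 + p / 2 * (2 * s / N) := by ring
        rw [ENNReal.mul_rpow_of_nonneg _ _ hsN, ← ENNReal.rpow_mul, this,
          ENNReal.rpow_add_of_nonneg _ _ zero_le_one (by positivity), ENNReal.rpow_one]
        ring

theorem rpow_le_rpow_mul_add {t e : ℝ≥0∞} (ht : t ≠ ⊤) (he : e ≠ 0)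
    {a p b : ℝ} (ha : 0 < a) (hap : a ≤ p) (hpb : p ≤ b) :
    t ^ p ≤ t ^ a * e ^ (p - a) + t ^ b * e ^ (p - b) := by
  rcases le_total t e with h | h
  · refine le_trans ?_ le_self_add
    calc t ^ p = t ^ a * t ^ (p - a) := by
          rw [← ENNReal.rpow_add_of_nonneg _ _ ha.le (by linarith), add_sub_cancel]
      _ ≤ _ := by
          gcongr
  · refine le_trans ?_ le_add_self
    have ht0 : t ≠ 0 := fun h0 => he (le_zero_iff.1 (h0 ▸ h))
    calc t ^ p = t ^ b * t ^ (p - b) := by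
          rw [← ENNReal.rpow_add _ _ ht0 ht, add_sub_cancel]
      _ ≤ _ := by
          rw [← neg_sub b p, ENNReal.rpow_neg, ENNReal.rpow_neg]
          gcongr

/-- Splitting `|v|^p` at the height `e = E(v)^{1/2}` replaces Hölder's inequality: with this
threshold both terms scale like `e^p`. Zero energy is treated apart, since negative powers of `e`
occur. -/
theorem Embeds.interpolate {W : Set (Space N → ℝ)} (hW : ∀ v ∈ W, Measurable v ∧ energy s v < ⊤)
    {a p b : ℝ} (ha0 : 0 < a) (hap : a ≤ p) (hpb : p ≤ b) (ha : Embeds W s a) (hb : Embeds W s b) :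
    Embeds W s p := by
  obtain ⟨C, hC, hle⟩ := ha
  obtain ⟨C', hC', hle'⟩ := hb
  refine ⟨C + C', ENNReal.add_ne_top.2 ⟨hC, hC'⟩, fun v hv => ?_⟩
  have hm := measurable_ofReal_abs (hW v hv).1
  have hE := (hW v hv).2
  have hsqrt : ∀ r : ℝ, energy s v ^ (r / 2) = (energy s v ^ (1 / 2 : ℝ)) ^ r := fun r => by
    rw [← ENNReal.rpow_mul]
    congr 1
    ring
  rcases eq_or_ne (energy s v) 0 with h0 | h0
  · have h1 := hle v hv
    rw [h0, ENNReal.zero_rpow_of_pos (by linarith), mul_zero, nonpos_iff_eq_zero,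
      lintegral_eq_zero_iff (hm.pow_const a)] at h1
    have hae : ∀ᵐ x, ENNReal.ofReal |v x| ^ p = 0 := by
      filter_upwards [h1] with x hx
      have hx' : ENNReal.ofReal |v x| = 0 := (ENNReal.rpow_eq_zero_iff_of_pos ha0).1 hx
      rw [hx', ENNReal.zero_rpow_of_pos (by linarith)]
    rw [lintegral_congr_ae hae]
    simp
  set e := energy s v ^ (1 / 2 : ℝ) with he
  have he0 : e ≠ 0 := by
    rw [he, Ne, ENNReal.rpow_eq_zero_iff_of_pos (by norm_num)]
    exact h0
  have he1 : e ≠ ⊤ := ENNReal.rpow_ne_top_of_nonneg (by norm_num) hE.ne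
  have hla := hle v hv
  have hlb := hle' v hv
  rw [hsqrt] at hla hlb ⊢
  calc ∫⁻ x, ENNReal.ofReal |v x| ^ p
      ≤ ∫⁻ x, (ENNReal.ofReal |v x| ^ a * e ^ (p - a) + ENNReal.ofReal |v x| ^ b * e ^ (p - b)) :=
        lintegral_mono fun x =>
          rpow_le_rpow_mul_add ENNReal.ofReal_ne_top he0 ha0 hap hpb
    _ = (∫⁻ x, ENNReal.ofReal |v x| ^ a) * e ^ (p - a) +
          (∫⁻ x, ENNReal.ofReal |v x| ^ b) * e ^ (p - b) := by
        rw [lintegral_add_left ((hm.pow_const a).mul_const _),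
          lintegral_mul_const _ (hm.pow_const a), lintegral_mul_const _ (hm.pow_const b)]
    _ ≤ C * e ^ a * e ^ (p - a) + C' * e ^ b * e ^ (p - b) := by gcongr
    _ = (C + C') * e ^ p := by
        rw [mul_assoc, mul_assoc, ← ENNReal.rpow_add _ _ he0 he1, ← ENNReal.rpow_add _ _ he0 he1,
          add_sub_cancel, add_sub_cancel, add_mul]

/-- In the conformal and in the supercritical case, an embedding for one exponent gives an embedding
for every larger exponent. -/
theorem Embeds.of_le {W : Set (Space 1 → ℝ)} (hs : 1 / 2 ≤ s)
    (hW : ∀ v ∈ W, Measurable v ∧ energy s v < ⊤) {a p : ℝ} (ha : 0 < a) (hap : a ≤ p)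
    (h : Embeds W s a) : Embeds W s p := by
  -- For `N = 1` and `2s ≥ 1` the bootstrap sends `b` to `2 + 2sb ≥ b + 2`, so the exponents are
  -- unbounded.
  have key : ∀ n : ℕ, ∃ b : ℝ, 0 < b ∧ a + 2 * n ≤ b ∧ Embeds W s b := by
    intro n
    induction n with
    | zero => exact ⟨a, ha, by simp, h⟩
    | succ n ih =>
      obtain ⟨b, hb0, hab, hb⟩ := ih
      refine ⟨_, ?_, ?_, hb.gagliardo_nirenberg le_rfl (by linarith) hW hb0⟩
      · push_cast
        have : 0 < s := by linarith
        positivity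
      · push_cast
        nlinarith
  obtain ⟨n, hn⟩ := exists_nat_ge p
  obtain ⟨b, hb0, hab, hb⟩ := key n
  have : (0 : ℝ) ≤ n := n.cast_nonneg
  exact Embeds.interpolate hW ha hap (by linarith) h hb

theorem IsTestFunction.lintegral_rpow_lt_top (hv : IsTestFunction Ω v) {p : ℝ} (hp : 0 < p) :
    ∫⁻ x, ENNReal.ofReal |v x| ^ p < ⊤ := by
  have h1 : Continuous fun x => |v x| ^ p := hv.1.continuous.abs.rpow_const fun _ => Or.inr hp.le
  have h2 : HasCompactSupport fun x => |v x| ^ p :=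
    hv.2.1.comp_left (g := fun t : ℝ => |t| ^ p) (by simp [Real.zero_rpow hp.ne'])
  have h3 := (h1.integrable_of_hasCompactSupport h2 (μ := volume)).lintegral_lt_top
  simpa only [ENNReal.ofReal_rpow_of_nonneg (abs_nonneg _) hp.le] using h3

/-- An embedding on test functions extends to the completion. -/
theorem Embeds.completion {p : ℝ} (hp : 0 < p)
    (h : Embeds {v : Space N → ℝ | ∃ Ω, IsTestFunction Ω v} s p) :
    Embeds {v : Space N → ℝ | Measurable v ∧ ∃ Ω, v ∈ D0 Ω s} s p := by
  obtain ⟨C, hC, hle⟩ := h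
  refine ⟨C * 2 ^ (p / 2), ENNReal.mul_ne_top hC (ENNReal.rpow_ne_top_of_nonneg (by positivity)
    (by simp)), ?_⟩
  rintro v ⟨hvm, Ω, hv⟩
  obtain ⟨φ, h1, h2, h3⟩ := D0.exists_approx hv hvm
  have hφm : ∀ n, Measurable (φ n) := fun n => (h1 n).measurable
  have hlim : Tendsto (fun n => C * (2 * energy s (φ n - v) + 2 * energy s v) ^ (p / 2)) atTop
      (𝓝 (C * (2 * energy s v) ^ (p / 2))) := by
    have h4 : Tendsto (fun n => 2 * energy s (φ n - v) + 2 * energy s v) atTop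
        (𝓝 (2 * energy s v)) := by
      simpa using (ENNReal.Tendsto.const_mul (a := 2) h2 (Or.inr ENNReal.ofNat_ne_top)).add_const
        (2 * energy s v)
    exact ENNReal.Tendsto.const_mul ((ENNReal.continuous_rpow_const.tendsto _).comp h4)
      (Or.inr hC)
  calc ∫⁻ x, ENNReal.ofReal |v x| ^ p
      = ∫⁻ x, liminf (fun n => ENNReal.ofReal |φ n x| ^ p) atTop := by
        refine lintegral_congr_ae ?_
        filter_upwards [h3] with x hx
        exact (((ENNReal.continuous_rpow_const.comp
          (ENNReal.continuous_ofReal.comp continuous_abs)).tendsto _).comp hx).liminf_eq.symm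
    _ ≤ liminf (fun n => ∫⁻ x, ENNReal.ofReal |φ n x| ^ p) atTop :=
        lintegral_liminf_le fun n => (measurable_ofReal_abs (hφm n)).pow_const p
    _ ≤ liminf (fun n => C * (2 * energy s (φ n - v) + 2 * energy s v) ^ (p / 2)) atTop := by
        refine liminf_le_liminf (Eventually.of_forall fun n => ?_)
        refine (hle _ ⟨Ω, h1 n⟩).trans ?_
        gcongr
        -- The quasi-triangle inequality suffices; it costs the factor `2 ^ (p / 2)` in the
        -- constant.
        have := energy_add_le (s := s) ((hφm n).sub hvm) hvm
        rwa [sub_add_cancel] at this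
    _ = C * (2 * energy s v) ^ (p / 2) := hlim.liminf_eq
    _ = _ := by rw [ENNReal.mul_rpow_of_nonneg _ _ (by positivity), mul_assoc]

/-- The fractional Sobolev inequality. -/
theorem embeds_sobolev (hN : 1 ≤ N) (hs0 : 0 < s) (hsN : 2 * s < N) :
    Embeds {v : Space N → ℝ | Measurable v ∧ ∃ Ω, v ∈ D0 Ω s} s (2 * N / (N - 2 * s)) := by
  have hN0 : (0 : ℝ) < N := by exact_mod_cast hN
  have hd : 0 < (N : ℝ) - 2 * s := by linarith
  set p : ℝ := 2 * N / (N - 2 * s) with hp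
  have hp0 : 0 < p := by positivity
  refine Embeds.completion hp0 ?_
  obtain ⟨C, hC, hle⟩ := exists_gagliardo_nirenberg (N := N) (s := s) hN hs0 hp0
  have hpp : 2 + 2 * s * p / N = p := by
    rw [hp]
    field_simp
    ring
  rw [hpp] at hle
  refine ⟨C ^ (p / 2), ENNReal.rpow_ne_top_of_nonneg (by positivity) hC, ?_⟩
  rintro v ⟨Ω, hv⟩
  have hfin := (hv.lintegral_rpow_lt_top hp0).ne
  have := hle v hv.measurable hfin
  set A := ∫⁻ x, ENNReal.ofReal |v x| ^ p with hA
  rcases eq_or_ne A 0 with h0 | h0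
  · rw [h0]; exact zero_le
  -- Since `p` is a fixed point of the bootstrap, `A` is on both sides and `A ^ (2 * s / N)` can be
  -- divided out. This needs `A` finite, which is why the argument runs on test functions first.
  have hpow : A ^ (1 - 2 * s / N) ≤ C * energy s v := by
    rw [ENNReal.rpow_sub _ _ h0 hfin, ENNReal.rpow_one]
    exact ENNReal.div_le_of_le_mul this
  have hinv : (1 - 2 * s / N) * (p / 2) = 1 := by
    rw [hp]
    field_simp
  calc A = (A ^ (1 - 2 * s / N)) ^ (p / 2) := by rw [← ENNReal.rpow_mul, hinv, ENNReal.rpow_one]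
    _ ≤ (C * energy s v) ^ (p / 2) := by gcongr
    _ = _ := ENNReal.mul_rpow_of_nonneg _ _ (by positivity)

theorem D0.lintegral_eq_normLq {q : ℝ} (hq : 0 < q) (hΩ : MeasurableSet Ω) (hu : u ∈ D0 Ω s) :
    ∫⁻ x, ENNReal.ofReal |u x| ^ q = normLq Ω q u ^ q := by
  have hq' : (ENNReal.ofReal q).toReal = q := ENNReal.toReal_ofReal hq.le
  rw [normLq, eLpNorm_eq_lintegral_rpow_enorm_toReal (by simpa using hq) ENNReal.ofReal_ne_top, hq',
    ← ENNReal.rpow_mul, one_div, inv_mul_cancel₀ hq.ne', ENNReal.rpow_one,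
    ← lintegral_indicator hΩ]
  refine lintegral_congr_ae ?_
  filter_upwards [D0.ae_eq_zero hu] with x hx
  by_cases hxΩ : x ∈ Ω
  · rw [indicator_of_mem hxΩ, Real.enorm_eq_ofReal_abs]
  · rw [indicator_of_notMem hxΩ, hx hxΩ, abs_zero, ENNReal.ofReal_zero, ENNReal.zero_rpow_of_pos hq]

/-- A compact embedding is bounded. -/
theorem CompactEmbedding.embeds {q : ℝ} (hq : 1 < q) (hΩ : MeasurableSet Ω)
    (h : CompactEmbedding Ω s q) :
    Embeds {v : Space N → ℝ | Measurable v ∧ v ∈ D0 Ω s} s q := by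
  have hq0 : 0 < q := by linarith
  by_contra hcon
  simp only [Embeds, not_exists, not_and] at hcon
  -- A violation of the bound with constant `n ^ q`, rescaled to have norm exactly `n`. A
  -- subsequence convergent in `L^q` would have bounded norms, which is absurd.
  have hbad : ∀ n : ℕ, ∃ w ∈ D0 Ω s, energy s w ≤ 1 ∧ normLq Ω q w = n := by
    intro n
    have h1 := hcon ((n : ℝ≥0∞) ^ q) (ENNReal.rpow_ne_top_of_nonneg hq0.le (by simp))
    push Not at h1
    obtain ⟨v, ⟨hvm, hv⟩, hlt⟩ := h1
    have hsq : energy s v ^ (q / 2) = (energy s v ^ (1 / 2 : ℝ)) ^ q := by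
      rw [← ENNReal.rpow_mul]
      congr 1
      ring
    rw [D0.lintegral_eq_normLq hq0 hΩ hv, hsq, ← ENNReal.mul_rpow_of_nonneg _ _ hq0.le,
      ENNReal.rpow_lt_rpow_iff hq0] at hlt
    set ν := normLq Ω q v with hν
    have hνtop : ν ≠ ⊤ := (h.1 v hv).2.ne
    have hν0 : 0 < ν.toReal := ENNReal.toReal_pos (pos_of_gt hlt).ne' hνtop
    have hνe : ν = ENNReal.ofReal ν.toReal := (ENNReal.ofReal_toReal hνtop).symm
    refine ⟨((n : ℝ) / ν.toReal) • v, D0.const_smul hv _, ?_, ?_⟩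
    · rw [energy_smul _ hvm]
      have h2 : ((n : ℝ≥0∞) * energy s v ^ (1 / 2 : ℝ)) ^ (2 : ℝ) ≤ ν ^ (2 : ℝ) :=
        ENNReal.rpow_le_rpow hlt.le zero_le_two
      rw [ENNReal.mul_rpow_of_nonneg _ _ zero_le_two, ← ENNReal.rpow_mul] at h2
      norm_num at h2
      rw [div_pow, ENNReal.ofReal_div_of_pos (by positivity), ENNReal.ofReal_pow (by positivity),
        ENNReal.ofReal_pow hν0.le, ← hνe, ENNReal.ofReal_natCast, ← ENNReal.mul_div_right_comm]
      exact ENNReal.div_le_of_le_mul (by simpa using h2)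
    · rw [normLq, eLpNorm_const_smul, ← normLq, ← hν, Real.enorm_eq_ofReal (by positivity)]
      nth_rw 2 [hνe]
      rw [← ENNReal.ofReal_mul (by positivity), div_mul_cancel₀ _ hν0.ne', ENNReal.ofReal_natCast]
  choose w hwD hwE hwn using hbad
  obtain ⟨v, hv, k, hk, hlim⟩ := h.2 w hwD ⟨1, fun n => by simpa using hwE n⟩
  have hq1 : 1 ≤ ENNReal.ofReal q := by
    rw [← ENNReal.ofReal_one]
    exact ENNReal.ofReal_le_ofReal hq.le
  obtain ⟨m, hm⟩ := ENNReal.exists_nat_gt (r := 1 + normLq Ω q v)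
    (ENNReal.add_ne_top.2 ⟨by simp, hv.2.ne⟩)
  obtain ⟨n, hn1, hn2⟩ :=
    ((ENNReal.tendsto_nhds_zero.1 hlim 1 one_pos).and (eventually_ge_atTop m)).exists
  have h3 := eLpNorm_add_le (((h.1 _ (hwD (k n))).1).sub hv.1) hv.1 hq1
  rw [sub_add_cancel] at h3
  have h4 : (m : ℝ≥0∞) ≤ k n := by exact_mod_cast hn2.trans (hk.id_le n)
  have h5 : ((k n : ℕ) : ℝ≥0∞) ≤ 1 + normLq Ω q v := by
    rw [← hwn (k n)]
    refine h3.trans ?_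
    gcongr
    · exact hn1
    · exact le_rfl
  exact absurd hm (not_lt.2 (h4.trans h5))

end FracSemilinear

/-! ### De Giorgi's iteration on an abstract measure space. -/

namespace FracSemilinear

/-- The geometric rate at which the energies of the truncations decay. -/
noncomputable def deGiorgiRate (p : ℝ) : ℝ := ((2 : ℝ) ^ (p - 1)) ^ (-(p / (p - 2)))

/-- The bound for the solution of the normalised truncation inequalities. -/
noncomputable def deGiorgiBound (p q : ℝ) : ℝ :=
  (4 ^ (p - 1) * (deGiorgiRate p) ^ (-(2 / p))) ^ (1 / (p - q))

theorem deGiorgiRate_pos (p : ℝ) : 0 < deGiorgiRate p := by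
  unfold deGiorgiRate
  positivity

theorem deGiorgiRate_lt_one {p : ℝ} (hp : 2 < p) : deGiorgiRate p < 1 := by
  have h1 : 0 < p / (p - 2) := div_pos (by linarith) (by linarith)
  exact Real.rpow_lt_one_of_one_lt_of_neg
    (Real.one_lt_rpow one_lt_two (by linarith)) (by linarith)

theorem deGiorgiBound_pos (p q : ℝ) : 0 < deGiorgiBound p q := by
  have := deGiorgiRate_pos p
  unfold deGiorgiBound
  positivity

theorem deGiorgiBound_rpow {p q : ℝ} (hqp : q < p) :
    deGiorgiBound p q ^ (p - q) = 4 ^ (p - 1) * (deGiorgiRate p) ^ (-(2 / p)) := by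
  have := deGiorgiRate_pos p
  rw [deGiorgiBound, ← Real.rpow_mul (by positivity), one_div,
    inv_mul_cancel₀ (by linarith : p - q ≠ 0) , Real.rpow_one]

/-- The factor in the recursion for the energies of the truncations. -/
noncomputable def deGiorgiFactor (p q : ℝ) (n : ℕ) : ℝ :=
  ((2 : ℝ) ^ (n + 2)) ^ (p - 1) / deGiorgiBound p q ^ (p - q)

theorem deGiorgiFactor_eq {p q : ℝ} (hqp : q < p) (n : ℕ) :
    deGiorgiFactor p q n = deGiorgiRate p ^ (2 / p) * ((2 : ℝ) ^ (p - 1)) ^ n := by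
  have h0 := deGiorgiRate_pos p
  rw [deGiorgiFactor, deGiorgiBound_rpow hqp, pow_add, Real.mul_rpow (by positivity) (by positivity),
    Real.rpow_neg h0.le, ← Real.rpow_natCast, ← Real.rpow_mul zero_le_two, mul_comm (n : ℝ),
    Real.rpow_mul zero_le_two, Real.rpow_natCast]
  norm_num
  field_simp

/-- This identity dictates the rate `η` and the bound: with `β = 2^{p-1}`, the rate solves
`(βη)^{p/2} = η`, and the bound makes the factor equal to `η^{2/p} β^n`. The recursion then maps
`η^n` exactly to `η^{n+1}`. -/
theorem deGiorgiFactor_mul_rpow {p q : ℝ} (hp : 2 < p) (hqp : q < p) (n : ℕ) :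
    (deGiorgiFactor p q n * deGiorgiRate p ^ n) ^ (p / 2) = deGiorgiRate p ^ (n + 1) := by
  have h0 := deGiorgiRate_pos p
  have hβ : (0 : ℝ) < 2 ^ (p - 1) := by positivity
  have h1 : ((2 : ℝ) ^ (p - 1) * deGiorgiRate p) ^ (p / 2) = deGiorgiRate p := by
    have hp2 : p - 2 ≠ 0 := by linarith
    have : (2 : ℝ) ^ (p - 1) * deGiorgiRate p = ((2 : ℝ) ^ (p - 1)) ^ (1 + -(p / (p - 2))) := by
      rw [Real.rpow_add hβ, Real.rpow_one, deGiorgiRate]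
    rw [this, ← Real.rpow_mul hβ.le, deGiorgiRate]
    congr 1
    field_simp
    ring
  rw [deGiorgiFactor_eq hqp, mul_assoc, ← mul_pow, Real.mul_rpow (by positivity) (by positivity),
    ← Real.rpow_mul h0.le, div_mul_div_cancel₀ (by linarith), div_self two_ne_zero, Real.rpow_one,
    ← Real.rpow_natCast, ← Real.rpow_mul (by positivity), mul_comm (n : ℝ),
    Real.rpow_mul (by positivity), h1, Real.rpow_natCast, pow_succ']

/-- Above the level of index `n + 1`, the excess `g` over the level of index `n` exceeds the gap `K
/ d`, `d = 2^{n+1}`. Hence `t ≤ g + K ≤ 2dg`, and the factor `(dg/K)^{p-q} ≥ 1` raises the power of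
`g` from `q` to `p`. -/
theorem deGiorgi_pointwise {p q K t : ℝ} (hq : 1 < q) (hqp : q < p) (hK : 0 < K) (n : ℕ)
    (ht : K * (1 - (1 / 2) ^ (n + 1)) < t) :
    t ^ (q - 1) * (t - K * (1 - (1 / 2) ^ (n + 1))) ≤
      ((2 : ℝ) ^ (n + 2)) ^ (p - 1) / K ^ (p - q) * (t - K * (1 - (1 / 2) ^ n)) ^ p := by
  set d : ℝ := 2 ^ (n + 1) with hd
  have hd0 : 0 < d := by positivity
  have hd1 : 1 ≤ d := one_le_pow₀ one_le_two
  have e1 : (1 / 2 : ℝ) ^ (n + 1) = 1 / d := by rw [div_pow, one_pow]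
  have e2 : (1 / 2 : ℝ) ^ n = 2 / d := by
    rw [div_pow, one_pow, hd, pow_succ]
    field_simp
  have e3 : (2 : ℝ) ^ (n + 2) = 2 * d := by rw [hd]; ring
  rw [e1] at ht ⊢
  rw [e2, e3]
  set g := t - K * (1 - 2 / d) with hg
  have hKd : 0 < K / d := by positivity
  have hgK : K / d < g := by
    have : g - K / d = t - K * (1 - 1 / d) := by rw [hg]; field_simp; ring
    linarith
  have hg0 : 0 < g := hKd.trans hgK
  have htg : t ≤ 2 * d * g := by
    have h1 : K ≤ d * g := by
      rw [div_lt_iff₀' hd0] at hgK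
      exact hgK.le
    have h2 : t ≤ g + K := by
      have : g + K - t = K * (2 / d) := by rw [hg]; ring
      have : 0 < K * (2 / d) := by positivity
      linarith
    nlinarith
  have hK1 : K * (1 - 1 / d) ≥ 0 := by
    refine mul_nonneg hK.le (sub_nonneg.2 ?_)
    rw [div_le_one hd0]
    exact hd1
  have ht0 : 0 < t := lt_of_le_of_lt hK1 ht
  have h3 : t - K * (1 - 1 / d) ≤ g := by
    have : g - (t - K * (1 - 1 / d)) = K / d := by rw [hg]; field_simp; ring
    linarith
  calc t ^ (q - 1) * (t - K * (1 - 1 / d)) ≤ (2 * d * g) ^ (q - 1) * g := by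
        refine mul_le_mul (Real.rpow_le_rpow ht0.le htg (by linarith)) h3 (by linarith)
          (by positivity)
    _ = (2 * d) ^ (q - 1) * g ^ q := by
        rw [Real.mul_rpow (by positivity) hg0.le, mul_assoc]
        congr 1
        rw [← Real.rpow_add_one hg0.ne', sub_add_cancel]
    _ ≤ (2 * d) ^ (q - 1) * ((d / K) ^ (p - q) * g ^ p) := by
        gcongr
        have h4 : (d / K) ^ (p - q) * g ^ p = (d / K * g) ^ (p - q) * g ^ q := by
          rw [Real.mul_rpow (by positivity) hg0.le, mul_assoc, ← Real.rpow_add hg0, sub_add_cancel]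
        rw [h4]
        refine le_mul_of_one_le_left (by positivity) (Real.one_le_rpow ?_ (by linarith))
        rw [div_lt_iff₀' hd0] at hgK
        rw [div_mul_eq_mul_div, one_le_div hK]
        exact hgK.le
    _ ≤ (2 * d) ^ (q - 1) * ((2 * d) ^ (p - q) / K ^ (p - q) * g ^ p) := by
        rw [Real.div_rpow hd0.le hK.le]
        gcongr
        linarith
    _ = (2 * d) ^ (p - 1) / K ^ (p - q) * g ^ p := by
        have : (2 * d) ^ (p - 1) = (2 * d) ^ (q - 1) * (2 * d) ^ (p - q) := by
          rw [← Real.rpow_add (by positivity)]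
          congr 1
          ring
        rw [this]
        ring

variable {α : Type*} [MeasurableSpace α] {μ : Measure α} {f : α → ℝ}

/-- De Giorgi's iteration, in normalised form. -/
theorem ae_le_deGiorgiBound {p q : ℝ} (hp : 2 < p) (hq : 1 < q) (hqp : q < p) (hf : Measurable f)
    (h1 : ∫⁻ x, ENNReal.ofReal (f x) ^ q ∂μ ≤ 1)
    (h2 : ∀ k : ℝ, 0 ≤ k → (∫⁻ x, ENNReal.ofReal (f x - k) ^ p ∂μ) ^ (2 / p) ≤
      ∫⁻ x, ENNReal.ofReal (f x) ^ (q - 1) * ENNReal.ofReal (f x - k) ∂μ) :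
    ∀ᵐ x ∂μ, f x ≤ deGiorgiBound p q := by
  have hp0 : 0 < p := by linarith
  set K := deGiorgiBound p q with hKdef
  have hK : 0 < K := deGiorgiBound_pos p q
  have hη := deGiorgiRate_pos p
  set X : ℕ → ℝ≥0∞ := fun n => ∫⁻ x, ENNReal.ofReal (f x - K * (1 - (1 / 2) ^ n)) ^ p ∂μ with hX
  have hmeas : ∀ k : ℝ, Measurable fun x => ENNReal.ofReal (f x - k) ^ p := fun k =>
    (ENNReal.measurable_ofReal.comp (hf.sub_const k)).pow_const p
  have hstep : ∀ n, X (n + 1) ≤ (ENNReal.ofReal (deGiorgiFactor p q n) * X n) ^ (p / 2) := by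
    intro n
    have hk : 0 ≤ K * (1 - (1 / 2) ^ (n + 1)) :=
      mul_nonneg hK.le (sub_nonneg.2 (pow_le_one₀ (by norm_num) (by norm_num)))
    have h3 := h2 _ hk
    have h4 : ∫⁻ x, ENNReal.ofReal (f x) ^ (q - 1) *
        ENNReal.ofReal (f x - K * (1 - (1 / 2) ^ (n + 1))) ∂μ ≤
        ENNReal.ofReal (deGiorgiFactor p q n) * X n := by
      rw [hX, ← lintegral_const_mul _ (hmeas _)]
      refine lintegral_mono fun x => ?_
      simp only
      rcases le_or_gt (f x) (K * (1 - (1 / 2) ^ (n + 1))) with h | h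
      · rw [ENNReal.ofReal_of_nonpos (sub_nonpos.2 h), mul_zero]
        exact zero_le
      · have hf0 : 0 < f x := hk.trans_lt h
        have hlt : K * (1 - (1 / 2) ^ n) < f x := by
          refine lt_of_le_of_lt ?_ h
          gcongr K * (1 - ?_)
          exact pow_le_pow_of_le_one (by norm_num) (by norm_num) n.le_succ
        have h5 := deGiorgi_pointwise hq hqp hK n h
        have h6 : 0 ≤ deGiorgiFactor p q n := by
          unfold deGiorgiFactor
          positivity
        rw [ENNReal.ofReal_rpow_of_pos hf0, ENNReal.ofReal_rpow_of_pos (sub_pos.2 hlt),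
          ← ENNReal.ofReal_mul (by positivity), ← ENNReal.ofReal_mul h6]
        exact ENNReal.ofReal_le_ofReal h5
    calc X (n + 1) = (X (n + 1) ^ (2 / p)) ^ (p / 2) := by
          rw [← ENNReal.rpow_mul, div_mul_div_cancel₀ hp0.ne', div_self two_ne_zero,
            ENNReal.rpow_one]
      _ ≤ _ := ENNReal.rpow_le_rpow (h3.trans h4) (by positivity)
  have hdecay : ∀ n, X n ≤ ENNReal.ofReal (deGiorgiRate p ^ n) := by
    intro n
    induction n with
    | zero =>
      -- At level 0 the right-hand side is the integral of `f₊^q`, which the normalisation bounds by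
      -- 1.
      have h3 := h2 0 le_rfl
      have h4 : ∫⁻ x, ENNReal.ofReal (f x) ^ (q - 1) * ENNReal.ofReal (f x - 0) ∂μ ≤ 1 := by
        refine le_trans (le_of_eq (lintegral_congr fun x => ?_)) h1
        rw [sub_zero]
        nth_rw 2 [← ENNReal.rpow_one (ENNReal.ofReal (f x))]
        rw [← ENNReal.rpow_add_of_nonneg _ _ (by linarith) zero_le_one, sub_add_cancel]
      have h5 := ENNReal.rpow_le_rpow (h3.trans h4) (by positivity : 0 ≤ p / 2)
      rw [← ENNReal.rpow_mul, div_mul_div_cancel₀ hp0.ne', div_self two_ne_zero,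
        ENNReal.rpow_one, ENNReal.one_rpow] at h5
      simpa [hX] using h5
    | succ n ih =>
      have h6 : 0 ≤ deGiorgiFactor p q n := by
        unfold deGiorgiFactor
        positivity
      calc X (n + 1) ≤ (ENNReal.ofReal (deGiorgiFactor p q n) * X n) ^ (p / 2) := hstep n
        _ ≤ (ENNReal.ofReal (deGiorgiFactor p q n) * ENNReal.ofReal (deGiorgiRate p ^ n)) ^
              (p / 2) := by gcongr
        _ = ENNReal.ofReal (deGiorgiRate p ^ (n + 1)) := by
            rw [← ENNReal.ofReal_mul h6, ENNReal.ofReal_rpow_of_nonneg (by positivity)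
              (by positivity), deGiorgiFactor_mul_rpow hp hqp]
  have hzero : ∫⁻ x, ENNReal.ofReal (f x - K) ^ p ∂μ = 0 := by
    -- All levels of the iteration lie below `K`.
    have hle : ∀ n, ∫⁻ x, ENNReal.ofReal (f x - K) ^ p ∂μ ≤
        ENNReal.ofReal (deGiorgiRate p ^ n) := by
      refine fun n => le_trans (lintegral_mono fun x => ?_) (hdecay n)
      refine ENNReal.rpow_le_rpow (ENNReal.ofReal_le_ofReal ?_) hp0.le
      have : 0 ≤ K * (1 / 2) ^ n := by positivity
      linarith
    have hlim : Tendsto (fun n => ENNReal.ofReal (deGiorgiRate p ^ n)) atTop (𝓝 0) := by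
      rw [← ENNReal.ofReal_zero]
      exact (ENNReal.continuous_ofReal.tendsto _).comp
        (tendsto_pow_atTop_nhds_zero_of_lt_one hη.le (deGiorgiRate_lt_one hp))
    exact le_zero_iff.1 (ge_of_tendsto' hlim hle)
  rw [lintegral_eq_zero_iff (hmeas K)] at hzero
  filter_upwards [hzero] with x hx
  have hx' := (ENNReal.rpow_eq_zero_iff_of_pos hp0).1 hx
  rw [ENNReal.ofReal_eq_zero] at hx'
  linarith

/-- De Giorgi's iteration, with its dependence on the data. -/
theorem ae_le_deGiorgiBound_mul {p q a σ : ℝ} (hp : 2 < p) (hq : 1 < q) (hqp : q < p)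
    (ha : 0 < a) (hσ : 0 < σ) (hf : Measurable f)
    (h1 : ∫⁻ x, ENNReal.ofReal (f x) ^ q ∂μ ≤ ENNReal.ofReal (a ^ q))
    (h2 : ∀ k : ℝ, 0 ≤ k → (∫⁻ x, ENNReal.ofReal (f x - k) ^ p ∂μ) ^ (2 / p) ≤
      ENNReal.ofReal (σ * a ^ (2 - q)) *
        ∫⁻ x, ENNReal.ofReal (f x) ^ (q - 1) * ENNReal.ofReal (f x - k) ∂μ) :
    ∀ᵐ x ∂μ, f x ≤ deGiorgiBound p q * σ ^ (p / (2 * (p - q))) * a := by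
  have hp0 : 0 < p := by linarith
  have hpq : p - q ≠ 0 := by linarith
  -- The height `h = y a` and the mass factor `c = y^q` of the measure are the two parameters that
  -- turn both constants into 1. The first condition reads `c h^{-q} a^q = 1`, the second
  -- `y^{2-2q/p} = σ`; this is the origin of the power of `λ`. Rescaling the measure plays the role
  -- of a dilation of the domain.
  set y := σ ^ (p / (2 * (p - q))) with hy
  have hy0 : 0 < y := by positivity
  have hyσ : y ^ (2 - 2 * q / p) = σ := by
    rw [hy, ← Real.rpow_mul hσ.le]
    have : p / (2 * (p - q)) * (2 - 2 * q / p) = 1 := by field_simp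
    rw [this, Real.rpow_one]
  set h := y * a with hh
  have hh0 : 0 < h := by positivity
  set c := ENNReal.ofReal (y ^ q) with hc
  have hc0 : c ≠ 0 := by
    rw [hc, Ne, ENNReal.ofReal_eq_zero, not_le]
    positivity
  have hfd : ∀ t : ℝ, ENNReal.ofReal (t / h) = ENNReal.ofReal h⁻¹ * ENNReal.ofReal t := fun t => by
    rw [← ENNReal.ofReal_mul (by positivity)]
    congr 1
    ring
  have hpow : ∀ r : ℝ, ENNReal.ofReal h⁻¹ ^ r = ENNReal.ofReal (h⁻¹ ^ r) := fun r =>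
    ENNReal.ofReal_rpow_of_pos (by positivity)
  have hmeas : ∀ k : ℝ, Measurable fun x => ENNReal.ofReal (f x - k) := fun k =>
    ENNReal.measurable_ofReal.comp (hf.sub_const k)
  have hmeas0 : Measurable fun x => ENNReal.ofReal (f x) := ENNReal.measurable_ofReal.comp hf
  have key := ae_le_deGiorgiBound (μ := c • μ) (f := fun x => f x / h) hp hq hqp (hf.div_const h)
    ?_ ?_
  · have key' := (Measure.ae_ennreal_smul_measure_iff hc0).1 key
    filter_upwards [key'] with x hx
    rw [div_le_iff₀ hh0] at hx
    rw [mul_assoc]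
    exact hx
  · simp only [hfd, lintegral_smul_measure]
    simp only [ENNReal.mul_rpow_of_nonneg _ _ (by linarith : 0 ≤ q), hpow]
    rw [lintegral_const_mul _ (hmeas0.pow_const q)]
    calc c • (ENNReal.ofReal (h⁻¹ ^ q) * ∫⁻ x, ENNReal.ofReal (f x) ^ q ∂μ)
        ≤ c • (ENNReal.ofReal (h⁻¹ ^ q) * ENNReal.ofReal (a ^ q)) := by gcongr
      _ = 1 := by
          rw [smul_eq_mul, hc, ← ENNReal.ofReal_mul (by positivity),
            ← ENNReal.ofReal_mul (by positivity), ← Real.mul_rpow (by positivity) ha.le,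
            ← Real.mul_rpow hy0.le (by positivity)]
          have : y * (h⁻¹ * a) = 1 := by rw [hh]; field_simp
          rw [this, Real.one_rpow, ENNReal.ofReal_one]
  · intro k hk
    have hsub : ∀ x, f x / h - k = (f x - k * h) / h := fun x => by field_simp
    simp only [hsub, hfd, lintegral_smul_measure]
    simp only [ENNReal.mul_rpow_of_nonneg _ _ hp0.le,
      ENNReal.mul_rpow_of_nonneg _ _ (by linarith : 0 ≤ q - 1), hpow]
    have e1 : ∀ x, ENNReal.ofReal (h⁻¹ ^ (q - 1)) * ENNReal.ofReal (f x) ^ (q - 1) *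
        (ENNReal.ofReal h⁻¹ * ENNReal.ofReal (f x - k * h)) =
        ENNReal.ofReal (h⁻¹ ^ q) *
          (ENNReal.ofReal (f x) ^ (q - 1) * ENNReal.ofReal (f x - k * h)) := fun x => by
      have : h⁻¹ ^ q = h⁻¹ ^ (q - 1) * h⁻¹ := by
        rw [← Real.rpow_add_one (by positivity), sub_add_cancel]
      rw [this, ENNReal.ofReal_mul (by positivity)]
      ring
    have hmeasY : ∀ k : ℝ, Measurable fun x =>
        ENNReal.ofReal (f x) ^ (q - 1) * ENNReal.ofReal (f x - k * h) := fun k =>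
      (hmeas0.pow_const _).mul (hmeas _)
    simp only [e1]
    rw [lintegral_const_mul _ ((hmeas _).pow_const p),
      lintegral_const_mul _ (hmeasY k)]
    have h3 := h2 (k * h) (by positivity)
    set X := ∫⁻ x, ENNReal.ofReal (f x - k * h) ^ p ∂μ
    set Y := ∫⁻ x, ENNReal.ofReal (f x) ^ (q - 1) * ENNReal.ofReal (f x - k * h) ∂μ
    have h2p : 0 ≤ 2 / p := by positivity
    rw [smul_eq_mul, smul_eq_mul, ENNReal.mul_rpow_of_nonneg _ _ h2p,
      ENNReal.mul_rpow_of_nonneg _ _ h2p]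
    calc c ^ (2 / p) * (ENNReal.ofReal (h⁻¹ ^ p) ^ (2 / p) * X ^ (2 / p))
        ≤ c ^ (2 / p) * (ENNReal.ofReal (h⁻¹ ^ p) ^ (2 / p) *
            (ENNReal.ofReal (σ * a ^ (2 - q)) * Y)) := by gcongr
      _ = c * (ENNReal.ofReal (h⁻¹ ^ q) * Y) := by
          rw [hc, ENNReal.ofReal_rpow_of_pos (by positivity),
            ENNReal.ofReal_rpow_of_pos (by positivity), ← mul_assoc, ← mul_assoc, ← mul_assoc,
            ← ENNReal.ofReal_mul (by positivity), ← ENNReal.ofReal_mul (by positivity),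
            ← ENNReal.ofReal_mul (by positivity)]
          congr 2
          have e2 : (y ^ q) ^ (2 / p) = y ^ (2 * q / p) := by
            rw [← Real.rpow_mul hy0.le]
            congr 1
            ring
          have e3 : (h⁻¹ ^ p) ^ (2 / p) = (y ^ 2)⁻¹ * (a ^ 2)⁻¹ := by
            rw [← Real.rpow_mul (by positivity), mul_div_cancel₀ _ hp0.ne', Real.rpow_two, hh]
            rw [mul_inv, mul_pow, inv_pow, inv_pow]
          have e4 : σ = y ^ 2 / y ^ (2 * q / p) := by
            rw [← hyσ, Real.rpow_sub hy0, Real.rpow_two]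
          have e5 : h⁻¹ ^ q = (y ^ q)⁻¹ * (a ^ q)⁻¹ := by
            rw [Real.inv_rpow hh0.le, hh, Real.mul_rpow hy0.le ha.le, mul_inv]
          rw [e2, e3, e5, e4, Real.rpow_sub ha, Real.rpow_two]
          field_simp

end FracSemilinear

/-! ### Smooth truncations and the truncation inequality for eigenfunctions. -/

namespace FracSemilinear

/-- A smooth regularisation of the truncation `t ↦ (t - k)₊`. -/
noncomputable def smoothTruncation (k ε t : ℝ) : ℝ :=
  ∫ τ in k..t, Real.smoothTransition ((τ - k) / ε)

section smoothTruncation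

variable {k ε : ℝ}

theorem continuous_smoothTransition_div (k ε : ℝ) :
    Continuous fun τ : ℝ => Real.smoothTransition ((τ - k) / ε) :=
  Real.smoothTransition.continuous.comp ((continuous_id.sub continuous_const).div_const ε)

theorem hasDerivAt_smoothTruncation (t : ℝ) :
    HasDerivAt (smoothTruncation k ε) (Real.smoothTransition ((t - k) / ε)) t :=
  ((continuous_smoothTransition_div k ε).integral_hasStrictDerivAt k t).hasDerivAt

theorem deriv_smoothTruncation :
    deriv (smoothTruncation k ε) = fun t => Real.smoothTransition ((t - k) / ε) :=
  funext fun t => (hasDerivAt_smoothTruncation t).deriv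

theorem contDiff_smoothTruncation : ContDiff ℝ ∞ (smoothTruncation k ε) := by
  refine contDiff_infty_iff_deriv.2
    ⟨fun t => (hasDerivAt_smoothTruncation t).differentiableAt, ?_⟩
  rw [deriv_smoothTruncation]
  exact Real.smoothTransition.contDiff.comp ((contDiff_id.sub contDiff_const).div_const ε)

theorem lipschitzWith_smoothTruncation : LipschitzWith 1 (smoothTruncation k ε) := by
  refine lipschitzWith_of_nnnorm_deriv_le
    (fun t => (hasDerivAt_smoothTruncation t).differentiableAt) fun t => ?_
  rw [deriv_smoothTruncation, ← NNReal.coe_le_coe, coe_nnnorm, Real.norm_eq_abs,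
    abs_of_nonneg (Real.smoothTransition.nonneg _)]
  exact Real.smoothTransition.le_one _

theorem monotone_smoothTruncation : Monotone (smoothTruncation k ε) := by
  refine monotone_of_deriv_nonneg
    (fun t => (hasDerivAt_smoothTruncation t).differentiableAt) fun t => ?_
  rw [deriv_smoothTruncation]
  exact Real.smoothTransition.nonneg _

theorem smoothTruncation_of_le (hε : 0 < ε) {t : ℝ} (h : t ≤ k) : smoothTruncation k ε t = 0 := by
  rw [smoothTruncation, intervalIntegral.integral_congr (g := fun _ => 0),
    intervalIntegral.integral_zero]
  intro τ hτ
  rw [uIcc_of_ge h] at hτ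
  exact Real.smoothTransition.zero_of_nonpos (div_nonpos_of_nonpos_of_nonneg
    (sub_nonpos.2 hτ.2) hε.le)

theorem smoothTruncation_nonneg (hε : 0 < ε) (t : ℝ) : 0 ≤ smoothTruncation k ε t := by
  rcases le_total t k with h | h
  · exact (smoothTruncation_of_le hε h).ge
  · exact (smoothTruncation_of_le hε le_rfl).ge.trans (monotone_smoothTruncation h)

theorem smoothTruncation_le (hε : 0 < ε) {t : ℝ} (h : k ≤ t) : smoothTruncation k ε t ≤ t - k := by
  have := (lipschitzWith_smoothTruncation (k := k) (ε := ε)).dist_le_mul t k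
  rw [smoothTruncation_of_le hε le_rfl, Real.dist_eq, Real.dist_eq, sub_zero,
    abs_of_nonneg (sub_nonneg.2 h), NNReal.coe_one, one_mul] at this
  exact (le_abs_self _).trans this

/-- The derivative is 1 beyond `k + ε`. With the upper bound `(t - k)₊`, this pins the
regularisation to the true truncation within `ε`. -/
theorem le_smoothTruncation (hε : 0 < ε) (t : ℝ) : t - k - ε ≤ smoothTruncation k ε t := by
  rcases le_total t (k + ε) with h | h
  · exact le_trans (by linarith) (smoothTruncation_nonneg hε t)
  · have hi := fun a b => (continuous_smoothTransition_div k ε).intervalIntegrable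
      (μ := volume) a b
    have h1 : ∫ τ in (k + ε)..t, Real.smoothTransition ((τ - k) / ε) = t - (k + ε) := by
      rw [intervalIntegral.integral_congr (g := fun _ => 1), intervalIntegral.integral_const,
        smul_eq_mul, mul_one]
      intro τ hτ
      rw [uIcc_of_le h] at hτ
      refine Real.smoothTransition.one_of_one_le ?_
      rw [one_le_div hε]
      linarith [hτ.1]
    have h2 := smoothTruncation_nonneg (k := k) hε (k + ε)
    rw [smoothTruncation] at h2 ⊢
    rw [← intervalIntegral.integral_add_adjacent_intervals (hi k (k + ε)) (hi (k + ε) t), h1]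
    linarith

end smoothTruncation

variable {N : ℕ} {s q lam : ℝ} {u v w : Space N → ℝ} {Ω : Set (Space N)}

/-- Testing with a nondecreasing contraction of `u` controls the energy of that contraction. -/
theorem energy_comp_le_energyForm {G : ℝ → ℝ} (hG : LipschitzWith 1 G) (hGmono : Monotone G)
    (hu : Measurable u) (hE : energy s u < ⊤) :
    energy s (G ∘ u) ≤ ENNReal.ofReal (energyForm s u (G ∘ u)) := by
  have hGm : Measurable G := hG.continuous.measurable
  have hGu : Measurable (G ∘ u) := hGm.comp hu
  set F : Space N × Space N → ℝ := fun z =>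
    (u z.1 - u z.2) * ((G ∘ u) z.1 - (G ∘ u) z.2) / ‖z.1 - z.2‖ ^ ((N : ℝ) + 2 * s) with hF
  have hFm : Measurable F := by
    rw [hF]
    fun_prop
  have hl : ∀ a b, |G a - G b| ≤ |a - b| := fun a b => by
    simpa [Real.dist_eq] using hG.dist_le_mul a b
  -- The first inequality gives the claim pointwise; the second dominates the integrand by the
  -- energy density of `u`, which justifies Fubini for the iterated integral `energyForm`.
  have hsgn : ∀ a b, (G a - G b) ^ 2 ≤ (a - b) * (G a - G b) ∧
      (a - b) * (G a - G b) ≤ (a - b) ^ 2 := by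
    intro a b
    have := hl a b
    rcases le_total a b with h | h
    · have h1 := hGmono h
      rw [abs_of_nonpos (sub_nonpos.2 h1), abs_of_nonpos (sub_nonpos.2 h)] at this
      constructor <;> nlinarith
    · have h1 := hGmono h
      rw [abs_of_nonneg (sub_nonneg.2 h1), abs_of_nonneg (sub_nonneg.2 h)] at this
      constructor <;> nlinarith
  have hF0 : ∀ z, 0 ≤ F z := fun z =>
    div_nonneg ((sq_nonneg _).trans (hsgn _ _).1) (by positivity)
  have hFle : ∀ z, ENNReal.ofReal (F z) ≤ energyDensity s u z := fun z =>
    ENNReal.ofReal_le_ofReal (div_le_div_of_nonneg_right (hsgn _ _).2 (by positivity))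
  have hFge : ∀ z, energyDensity s (G ∘ u) z ≤ ENNReal.ofReal (F z) := fun z =>
    ENNReal.ofReal_le_ofReal (div_le_div_of_nonneg_right (hsgn _ _).1 (by positivity))
  have hint : Integrable F (volume.prod volume) := by
    refine ⟨hFm.aestronglyMeasurable, ?_⟩
    rw [hasFiniteIntegral_iff_ofReal (ae_of_all _ hF0)]
    refine (lintegral_mono hFle).trans_lt ?_
    rwa [← energy_eq_lintegral_prod hu]
  have hform : energyForm s u (G ∘ u) = ∫ z, F z ∂(volume.prod volume) :=
    (integral_prod F hint).symm
  rw [hform, ofReal_integral_eq_lintegral_ofReal hint (ae_of_all _ hF0),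
    energy_eq_lintegral_prod hGu]
  exact lintegral_mono hFge

theorem normLq_congr (h : u =ᵐ[volume] v) : normLq Ω q u = normLq Ω q v :=
  eLpNorm_congr_ae (ae_restrict_of_ae h)

theorem IsEigenfunction.congr (hu : IsEigenfunction Ω s q lam u) (h : u =ᵐ[volume] v) :
    IsEigenfunction Ω s q lam v := by
  refine ⟨D0.congr hu.1 h, fun h0 => hu.2.1 (h.trans h0), fun φ hφ => ?_⟩
  rw [← energyForm_congr h (ae_eq_refl φ), hu.2.2 φ hφ, normLq_congr h]
  congr 1
  refine integral_congr_ae ?_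
  filter_upwards [ae_restrict_of_ae h] with x hx
  rw [hx]

theorem IsEigenfunction.neg (hu : IsEigenfunction Ω s q lam u) :
    IsEigenfunction Ω s q lam (-u) := by
  refine ⟨D0.neg hu.1, fun h0 => hu.2.1 ?_, fun φ hφ => ?_⟩
  · filter_upwards [h0] with x hx
    simpa using hx
  · have h1 : energyForm s (-u) φ = -energyForm s u φ := by
      unfold energyForm
      rw [← integral_neg]
      congr 1
      funext x
      rw [← integral_neg]
      congr 1
      funext y
      simp only [Pi.neg_apply]
      ring
    have h2 : normLq Ω q (-u) = normLq Ω q u := eLpNorm_neg _ _ _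
    rw [h1, h2, hu.2.2 φ hφ, ← mul_neg, ← integral_neg]
    congr 2
    funext x
    simp only [Pi.neg_apply, abs_neg]
    ring

theorem D0.normLq_pos (hq : 0 < q) (hΩ : MeasurableSet Ω) (hum : Measurable u) (hu : u ∈ D0 Ω s)
    (h0 : ¬ u =ᵐ[volume] 0) : normLq Ω q u ≠ 0 := by
  intro h
  have h1 := D0.lintegral_eq_normLq hq hΩ hu
  rw [h, ENNReal.zero_rpow_of_pos hq, lintegral_eq_zero_iff
    ((measurable_ofReal_abs hum).pow_const q)] at h1
  refine h0 ?_
  filter_upwards [h1] with x hx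
  have hx' := (ENNReal.rpow_eq_zero_iff_of_pos hq).1 hx
  rw [ENNReal.ofReal_eq_zero] at hx'
  exact abs_nonpos_iff.1 hx'

theorem IsEigenfunction.energy_comp_le (hN : 1 ≤ N) (hs0 : 0 < s) (hs1 : s < 1)
    (hu : IsEigenfunction Ω s q lam u) (hum : Measurable u) {G : ℝ → ℝ} (hG : ContDiff ℝ ∞ G)
    (hG0 : G 0 = 0) (hGL : LipschitzWith 1 G) (hGmono : Monotone G) :
    energy s (G ∘ u) ≤ ENNReal.ofReal (lam * (normLq Ω q u).toReal ^ (2 - q) *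
      ∫ x in Ω, |u x| ^ (q - 2) * u x * G (u x)) := by
  have h1 := energy_comp_le_energyForm hGL hGmono hum (D0.energy_lt_top hN hs0 hs1 hu.1)
  rwa [hu.2.2 _ (D0.comp hN hs0 hs1 hG hG0 hGL hum hu.1)] at h1

variable {p : ℝ} {C : ℝ≥0∞}

/-- Testing with `u` itself: for `lam ≤ 0` the energy would vanish, and the embedding would give `u
= 0`. -/
theorem IsEigenfunction.lam_pos (hN : 1 ≤ N) (hs0 : 0 < s) (hs1 : s < 1) (hp : 0 < p)
    (hC : ∀ v ∈ D0 Ω s, Measurable v →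
      (∫⁻ x, ENNReal.ofReal |v x| ^ p) ^ (2 / p) ≤ C * energy s v)
    (hu : IsEigenfunction Ω s q lam u) (hum : Measurable u) : 0 < lam := by
  by_contra hlam
  refine hu.2.1 ?_
  have h1 := hu.energy_comp_le hN hs0 hs1 hum contDiff_id rfl LipschitzWith.id monotone_id
  have h2 : lam * (normLq Ω q u).toReal ^ (2 - q) *
      ∫ x in Ω, |u x| ^ (q - 2) * u x * id (u x) ≤ 0 := by
    refine mul_nonpos_of_nonpos_of_nonneg
      (mul_nonpos_of_nonpos_of_nonneg (not_lt.1 hlam) (by positivity)) ?_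
    refine integral_nonneg fun x => ?_
    simp only [id_eq, Pi.zero_apply, mul_assoc]
    exact mul_nonneg (by positivity) (mul_self_nonneg _)
  rw [ENNReal.ofReal_of_nonpos h2, Function.id_comp] at h1
  have h3 := hC u hu.1 hum
  rw [le_zero_iff.1 h1, mul_zero, nonpos_iff_eq_zero,
    ENNReal.rpow_eq_zero_iff_of_pos (by positivity),
    lintegral_eq_zero_iff ((measurable_ofReal_abs hum).pow_const p)] at h3
  filter_upwards [h3] with x hx
  have hx' := (ENNReal.rpow_eq_zero_iff_of_pos hp).1 hx
  rw [ENNReal.ofReal_eq_zero] at hx'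
  exact abs_nonpos_iff.1 hx'

/-- The truncation inequality for an eigenfunction. -/
theorem IsEigenfunction.lintegral_truncation_le (hN : 1 ≤ N) (hs0 : 0 < s) (hs1 : s < 1)
    (hp : 0 < p) (hlam : 0 ≤ lam)
    (hC : ∀ v ∈ D0 Ω s, Measurable v →
      (∫⁻ x, ENNReal.ofReal |v x| ^ p) ^ (2 / p) ≤ C * energy s v)
    (hu : IsEigenfunction Ω s q lam u) (hum : Measurable u) {k : ℝ} (hk : 0 ≤ k) :
    (∫⁻ x, ENNReal.ofReal (u x - k) ^ p) ^ (2 / p) ≤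
      C * ENNReal.ofReal (lam * (normLq Ω q u).toReal ^ (2 - q)) *
        ∫⁻ x, ENNReal.ofReal (u x) ^ (q - 1) * ENNReal.ofReal (u x - k) := by
  set R := C * ENNReal.ofReal (lam * (normLq Ω q u).toReal ^ (2 - q)) *
    ∫⁻ x, ENNReal.ofReal (u x) ^ (q - 1) * ENNReal.ofReal (u x - k) with hR
  have hnn : 0 ≤ lam * (normLq Ω q u).toReal ^ (2 - q) := by positivity
  have hinv : 2 / p * (p / 2) = 1 := by field_simp
  -- The smooth truncation lies above `u - k - ε` and below `(u - k)₊`, so the bound is uniform in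
  -- `ε`; Fatou's lemma then removes `ε`.
  have key : ∀ ε : ℝ, 0 < ε → ∫⁻ x, ENNReal.ofReal (u x - k - ε) ^ p ≤ R ^ (p / 2) := by
    intro ε hε
    set G := smoothTruncation k ε with hG
    have hG0 : G 0 = 0 := smoothTruncation_of_le hε hk
    have hD : G ∘ u ∈ D0 Ω s := D0.comp hN hs0 hs1 contDiff_smoothTruncation hG0
      lipschitzWith_smoothTruncation hum hu.1
    have hGum : Measurable (G ∘ u) :=
      lipschitzWith_smoothTruncation.continuous.measurable.comp hum
    have h1 := hu.energy_comp_le hN hs0 hs1 hum contDiff_smoothTruncation hG0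
      lipschitzWith_smoothTruncation monotone_smoothTruncation
    have hpt : ∀ x, 0 ≤ |u x| ^ (q - 2) * u x * G (u x) ∧
        ENNReal.ofReal (|u x| ^ (q - 2) * u x * G (u x)) ≤
        ENNReal.ofReal (u x) ^ (q - 1) * ENNReal.ofReal (u x - k) := by
      intro x
      rcases le_or_gt (u x) k with h | h
      · rw [hG, smoothTruncation_of_le hε h, mul_zero, ENNReal.ofReal_zero]
        exact ⟨le_rfl, zero_le⟩
      · have hux : 0 < u x := hk.trans_lt h
        have hGx := smoothTruncation_nonneg (k := k) hε (u x)
        refine ⟨mul_nonneg (by positivity) hGx, ?_⟩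
        rw [abs_of_pos hux, ← Real.rpow_add_one hux.ne', ENNReal.ofReal_rpow_of_pos hux,
          ← ENNReal.ofReal_mul (by positivity)]
        have : q - 2 + 1 = q - 1 := by ring
        rw [this]
        refine ENNReal.ofReal_le_ofReal ?_
        gcongr
        exact smoothTruncation_le hε h.le
    have hint : ENNReal.ofReal (∫ x in Ω, |u x| ^ (q - 2) * u x * G (u x)) ≤
        ∫⁻ x, ENNReal.ofReal (u x) ^ (q - 1) * ENNReal.ofReal (u x - k) := by
      have hmeas : Measurable fun x => |u x| ^ (q - 2) * u x * G (u x) :=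
        ((hum.abs.pow_const _).mul hum).mul hGum
      rw [integral_eq_lintegral_of_nonneg_ae (ae_of_all _ fun x => (hpt x).1)
        hmeas.aestronglyMeasurable]
      -- No integrability is needed: if the integral diverges, the Bochner integral is 0 by default
      -- and the inequality still holds.
      refine ENNReal.ofReal_toReal_le.trans ((setLIntegral_le_lintegral _ _).trans ?_)
      exact lintegral_mono fun x => (hpt x).2
    have h2 : (∫⁻ x, ENNReal.ofReal |(G ∘ u) x| ^ p) ^ (2 / p) ≤ R := by
      refine (hC _ hD hGum).trans ?_
      rw [hR, mul_assoc]
      gcongr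
      refine h1.trans ?_
      rw [ENNReal.ofReal_mul hnn]
      gcongr
    calc ∫⁻ x, ENNReal.ofReal (u x - k - ε) ^ p ≤ ∫⁻ x, ENNReal.ofReal |(G ∘ u) x| ^ p := by
          refine lintegral_mono fun x => ?_
          refine ENNReal.rpow_le_rpow (ENNReal.ofReal_le_ofReal ?_) hp.le
          exact (le_smoothTruncation hε _).trans (le_abs_self _)
      _ = ((∫⁻ x, ENNReal.ofReal |(G ∘ u) x| ^ p) ^ (2 / p)) ^ (p / 2) := by
          rw [← ENNReal.rpow_mul, hinv, ENNReal.rpow_one]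
      _ ≤ R ^ (p / 2) := by gcongr
  have hlim : ∫⁻ x, ENNReal.ofReal (u x - k) ^ p ≤ R ^ (p / 2) := by
    set ε : ℕ → ℝ := fun n => 1 / ((n : ℝ) + 1) with hε
    have hε0 : Tendsto ε atTop (𝓝 0) := tendsto_one_div_add_atTop_nhds_zero_nat
    calc ∫⁻ x, ENNReal.ofReal (u x - k) ^ p
        = ∫⁻ x, liminf (fun n => ENNReal.ofReal (u x - k - ε n) ^ p) atTop := by
          refine lintegral_congr fun x => ?_
          have h1 : Tendsto (fun n => u x - k - ε n) atTop (𝓝 (u x - k)) := by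
            simpa using hε0.const_sub (u x - k)
          exact (((ENNReal.continuous_rpow_const.comp ENNReal.continuous_ofReal).tendsto
            _).comp h1).liminf_eq.symm
      _ ≤ liminf (fun n => ∫⁻ x, ENNReal.ofReal (u x - k - ε n) ^ p) atTop :=
          lintegral_liminf_le fun n => (ENNReal.measurable_ofReal.comp
            ((hum.sub_const k).sub_const _)).pow_const p
      _ ≤ R ^ (p / 2) := liminf_le_of_frequently_le'
          (Frequently.of_forall fun n => key _ (by positivity))
  calc (∫⁻ x, ENNReal.ofReal (u x - k) ^ p) ^ (2 / p) ≤ (R ^ (p / 2)) ^ (2 / p) := by gcongr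
    _ = R := by rw [← ENNReal.rpow_mul, mul_comm, hinv, ENNReal.rpow_one]

theorem IsEigenfunction.ae_le (hN : 1 ≤ N) (hs0 : 0 < s) (hs1 : s < 1) (hΩ : MeasurableSet Ω)
    (hp : 2 < p) (hq : 1 < q) (hqp : q < p) {c : ℝ} (hc : 0 < c)
    (hC : ∀ v ∈ D0 Ω s, Measurable v →
      (∫⁻ x, ENNReal.ofReal |v x| ^ p) ^ (2 / p) ≤ ENNReal.ofReal c * energy s v)
    (hu : IsEigenfunction Ω s q lam u) (hum : Measurable u) (hfin : normLq Ω q u ≠ ⊤) :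
    ∀ᵐ x, u x ≤ deGiorgiBound p q * (c * lam) ^ (p / (2 * (p - q))) * (normLq Ω q u).toReal := by
  have hp0 : 0 < p := by linarith
  have hq0 : 0 < q := by linarith
  have hlam := hu.lam_pos hN hs0 hs1 hp0 hC hum
  have ha := ENNReal.toReal_pos (D0.normLq_pos hq0 hΩ hum hu.1 hu.2.1) hfin
  refine ae_le_deGiorgiBound_mul hp hq hqp ha (mul_pos hc hlam) hum ?_ fun k hk => ?_
  · rw [← ENNReal.ofReal_rpow_of_pos ha, ENNReal.ofReal_toReal hfin,
      ← D0.lintegral_eq_normLq hq0 hΩ hu.1]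
    refine lintegral_mono fun x => ENNReal.rpow_le_rpow (ENNReal.ofReal_le_ofReal ?_) hq0.le
    exact le_abs_self _
  · have := hu.lintegral_truncation_le hN hs0 hs1 hp0 hlam.le hC hum hk
    rwa [← ENNReal.ofReal_mul hc.le, ← mul_assoc] at this

/-- The `L^∞` bound for eigenfunctions, in terms of the constant of an embedding. -/
theorem IsEigenfunction.eLpNorm_top_le (hN : 1 ≤ N) (hs0 : 0 < s) (hs1 : s < 1)
    (hΩ : MeasurableSet Ω) (hp : 2 < p) (hq : 1 < q) (hqp : q < p) {c : ℝ} (hc : 0 < c)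
    (hC : ∀ v ∈ D0 Ω s, Measurable v →
      (∫⁻ x, ENNReal.ofReal |v x| ^ p) ^ (2 / p) ≤ ENNReal.ofReal c * energy s v)
    (hu : IsEigenfunction Ω s q lam u) (hfin : normLq Ω q u ≠ ⊤) :
    eLpNorm u ⊤ (volume.restrict Ω) ≤
      ENNReal.ofReal (deGiorgiBound p q * (c * lam) ^ (p / (2 * (p - q)))) * normLq Ω q u := by
  obtain ⟨u', hu', hae⟩ := D0.aemeasurable hu.1
  rw [eLpNorm_congr_ae (ae_restrict_of_ae hae)]
  rw [normLq_congr hae] at hfin ⊢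
  replace hu := hu.congr hae
  have hneg : normLq Ω q (-u') = normLq Ω q u' := eLpNorm_neg _ _ _
  have h1 := hu.ae_le hN hs0 hs1 hΩ hp hq hqp hc hC hu' hfin
  -- The iteration bounds only from above; the lower bound comes from `-u'`, also an eigenfunction.
  have h2 := hu.neg.ae_le hN hs0 hs1 hΩ hp hq hqp hc hC hu'.neg (hneg ▸ hfin)
  rw [hneg] at h2
  rw [eLpNorm_exponent_top]
  have hlam := hu.lam_pos hN hs0 hs1 (by linarith) hC hu'
  have hK := deGiorgiBound_pos p q
  refine (eLpNormEssSup_le_of_ae_bound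
    (C := deGiorgiBound p q * (c * lam) ^ (p / (2 * (p - q))) * (normLq Ω q u').toReal)
    (ae_restrict_of_ae ?_)).trans (le_of_eq ?_)
  · filter_upwards [h1, h2] with x hx hx'
    rw [Real.norm_eq_abs]
    exact abs_le'.2 ⟨hx, hx'⟩
  · rw [ENNReal.ofReal_mul (by positivity), ENNReal.ofReal_toReal hfin]

end FracSemilinear

/-! ### Choice of the exponent and conclusion. -/

namespace FracSemilinear

theorem Embeds.exists_const {N : ℕ} {s p : ℝ} {W : Set (Space N → ℝ)} (hp : 0 < p)
    (h : Embeds W s p) : ∃ c : ℝ, 0 < c ∧ ∀ v ∈ W,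
      (∫⁻ x, ENNReal.ofReal |v x| ^ p) ^ (2 / p) ≤ ENNReal.ofReal c * energy s v := by
  obtain ⟨C, hC, hle⟩ := h
  have h2p : 0 ≤ 2 / p := by positivity
  have hCt : C ^ (2 / p) ≠ ⊤ := ENNReal.rpow_ne_top_of_nonneg h2p hC
  refine ⟨(C ^ (2 / p)).toReal + 1, by positivity, fun v hv => ?_⟩
  calc (∫⁻ x, ENNReal.ofReal |v x| ^ p) ^ (2 / p) ≤ (C * energy s v ^ (p / 2)) ^ (2 / p) := by
        gcongr
        exact hle v hv
    _ = C ^ (2 / p) * energy s v := by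
        rw [ENNReal.mul_rpow_of_nonneg _ _ h2p, ← ENNReal.rpow_mul,
          div_mul_div_cancel₀ two_ne_zero, div_self hp.ne', ENNReal.rpow_one]
    _ ≤ _ := by
        gcongr
        rw [ENNReal.le_ofReal_iff_toReal_le hCt (by positivity)]
        linarith

/-- On the line and for `1/2 ≤ s`, an embedding into `L^a` for some `a ≤ 2q` gives the bound with the
first power of the eigenvalue. -/
theorem exists_eLpNorm_top_le_of_embeds {s q a : ℝ} (hs0 : 0 < s) (hs1 : s < 1) (hs : 1 / 2 ≤ s)
    (hq : 1 < q) (ha : 0 < a) (haq : a ≤ 2 * q) {S : Set (Set (Space 1))}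
    (h : Embeds {v : Space 1 → ℝ | Measurable v ∧ ∃ Ω ∈ S, v ∈ D0 Ω s} s a) :
    ∃ C : ℝ, 0 < C ∧ ∀ Ω ∈ S, IsOpen Ω → CompactEmbedding Ω s q → ∀ lam : ℝ,
      ∀ u : Space 1 → ℝ, IsEigenfunction Ω s q lam u →
        eLpNorm u ⊤ (volume.restrict Ω) ≤ ENNReal.ofReal (C * lam) * normLq Ω q u := by
  have hW : ∀ v ∈ {v : Space 1 → ℝ | Measurable v ∧ ∃ Ω ∈ S, v ∈ D0 Ω s},
      Measurable v ∧ energy s v < ⊤ := by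
    rintro v ⟨hvm, Ω, -, hv⟩
    exact ⟨hvm, D0.energy_lt_top le_rfl hs0 hs1 hv⟩
  -- The exponent is `p = 2q`: it exceeds 2 and `q`, and makes `p / (2 * (p - q))` equal to 1. The
  -- constant depends on the family `S`, not on the single `Ω`.
  obtain ⟨c, hc, hle⟩ := (h.of_le hs hW ha haq).exists_const (by linarith)
  refine ⟨deGiorgiBound (2 * q) q * c, mul_pos (deGiorgiBound_pos _ _) hc,
    fun Ω hΩS hΩ hcomp lam u hu => ?_⟩
  have := hu.eLpNorm_top_le le_rfl hs0 hs1 hΩ.measurableSet (by linarith) hq (by linarith) hc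
    (fun v hv hvm => hle v ⟨hvm, Ω, hΩS, hv⟩) (hcomp.1 u hu.1).2.ne
  have hθ : 2 * q / (2 * (2 * q - q)) = 1 := by
    rw [two_mul q, add_sub_cancel_right, ← two_mul]
    exact div_self (by linarith)
  rwa [hθ, Real.rpow_one, ← mul_assoc] at this

end FracSemilinear

theorem mainTheorem8 (N : ℕ) (hN : 1 ≤ N) (s q : ℝ) (hs0 : 0 < s) (hs1 : s < 1)
    (hq1 : 1 < q) (hq2 : ENNReal.ofReal q < FracSemilinear.sobolevConj N s) :
    (FracSemilinear.sobolevConj N s ≠ ⊤ →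
      ∃ C : ℝ, 0 < C ∧ ∀ Ω : Set (FracSemilinear.Space N), IsOpen Ω →
        FracSemilinear.CompactEmbedding Ω s q →
        ∀ lam ∈ FracSemilinear.spectrumS Ω s q, ∀ u : FracSemilinear.Space N → ℝ,
          FracSemilinear.IsEigenfunction Ω s q lam u →
          eLpNorm u ⊤ (volume.restrict Ω) ≤
            ENNReal.ofReal (C * lam ^ ((FracSemilinear.sobolevConj N s).toReal /
              (2 * ((FracSemilinear.sobolevConj N s).toReal - q)))) *
              FracSemilinear.normLq Ω q u) ∧
    (FracSemilinear.sobolevConj N s = ⊤ →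
      (∀ m : ℝ≥0∞, m ≠ ⊤ →
        ∃ C : ℝ, 0 < C ∧ ∀ Ω : Set (FracSemilinear.Space N), IsOpen Ω → volume Ω = m →
          FracSemilinear.CompactEmbedding Ω s q →
          ∀ lam ∈ FracSemilinear.spectrumS Ω s q, ∀ u : FracSemilinear.Space N → ℝ,
            FracSemilinear.IsEigenfunction Ω s q lam u →
            eLpNorm u ⊤ (volume.restrict Ω) ≤
              ENNReal.ofReal (C * lam) * FracSemilinear.normLq Ω q u) ∧
      (∀ Ω : Set (FracSemilinear.Space N), IsOpen Ω → volume Ω = ⊤ →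
        FracSemilinear.CompactEmbedding Ω s q →
        ∃ C : ℝ, 0 < C ∧
          ∀ lam ∈ FracSemilinear.spectrumS Ω s q, ∀ u : FracSemilinear.Space N → ℝ,
            FracSemilinear.IsEigenfunction Ω s q lam u →
            eLpNorm u ⊤ (volume.restrict Ω) ≤
              ENNReal.ofReal (C * lam) * FracSemilinear.normLq Ω q u)) := by
  have hN0 : (0 : ℝ) < N := by exact_mod_cast hN
  refine ⟨fun hne => ?_, fun htop => ?_⟩
  · have hsN : 2 * s < N := by
      by_contra hcon
      exact hne (if_neg hcon)
    have hstar : FracSemilinear.sobolevConj N s = ENNReal.ofReal (2 * N / (N - 2 * s)) :=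
      if_pos hsN
    have hd : 0 < (N : ℝ) - 2 * s := by linarith
    have hp0 : 0 < 2 * N / (N - 2 * s) := by positivity
    rw [hstar, ENNReal.ofReal_lt_ofReal_iff hp0] at hq2
    rw [hstar, ENNReal.toReal_ofReal hp0.le]
    have hp2 : 2 < 2 * N / (N - 2 * s) := by
      rw [lt_div_iff₀ hd]
      linarith
    obtain ⟨c, hc, hle⟩ := (FracSemilinear.embeds_sobolev hN hs0 hsN).exists_const hp0
    set p := 2 * N / (N - 2 * s) with hp
    have hK := FracSemilinear.deGiorgiBound_pos p q
    refine ⟨FracSemilinear.deGiorgiBound p q * c ^ (p / (2 * (p - q))), by positivity,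
      fun Ω hΩ hcomp lam hlam u hu => ?_⟩
    -- A critical value is an energy, hence nonnegative; this allows `(c * lam) ^ θ` to be split.
    have hlam0 : 0 ≤ lam := by
      obtain ⟨w, -, rfl⟩ := hlam
      exact ENNReal.toReal_nonneg
    have := hu.eLpNorm_top_le hN hs0 hs1 hΩ.measurableSet hp2 hq1 hq2 hc
      (fun v hv hvm => hle v ⟨hvm, Ω, hv⟩) (hcomp.1 u hu.1).2.ne
    rwa [Real.mul_rpow hc.le hlam0, ← mul_assoc] at this
  · have hsN : ¬ 2 * s < N := fun hcon => by
      rw [FracSemilinear.sobolevConj, if_pos hcon] at htop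
      exact ENNReal.ofReal_ne_top htop
    -- From `N ≤ 2s < 2`.
    have hN1 : N = 1 := by
      have h2 : (N : ℝ) < 2 := by linarith
      have h3 : N < 2 := by exact_mod_cast h2
      omega
    subst hN1
    have hs : 1 / 2 ≤ s := by
      push_cast at hsN
      linarith
    refine ⟨fun m hm => ?_, fun Ω hΩ _ hcomp => ?_⟩
    -- Poincaré is uniform over all sets of measure `m`, so the bootstrap starts at exponent 2 on
    -- their union of energy spaces.
    · obtain ⟨C₀, hC₀, hle⟩ :=
        FracSemilinear.exists_lintegral_sq_le_energy (N := 1) le_rfl hs0 m hm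
      have hemb : FracSemilinear.Embeds {v : FracSemilinear.Space 1 → ℝ | Measurable v ∧
          ∃ Ω ∈ {Ω : Set (FracSemilinear.Space 1) | IsOpen Ω ∧ volume Ω = m},
            v ∈ FracSemilinear.D0 Ω s} s 2 := by
        refine ⟨C₀, hC₀, ?_⟩
        rintro v ⟨hvm, Ω, ⟨hΩ, hΩm⟩, hv⟩
        rw [div_self two_ne_zero, ENNReal.rpow_one]
        exact hle Ω hΩ.measurableSet hΩm v hvm (FracSemilinear.D0.ae_eq_zero hv)
      obtain ⟨C, hC, h⟩ := FracSemilinear.exists_eLpNorm_top_le_of_embeds hs0 hs1 hs hq1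
        two_pos (by linarith) hemb
      exact ⟨C, hC, fun Ω hΩ hΩm hcomp lam _ u hu => h Ω ⟨hΩ, hΩm⟩ hΩ hcomp lam u hu⟩
    -- With infinite measure the bootstrap starts at exponent `q`, from the compact embedding; hence
    -- a constant that depends on `Ω` itself.
    · have hemb : FracSemilinear.Embeds {v : FracSemilinear.Space 1 → ℝ | Measurable v ∧
          ∃ Ω' ∈ ({Ω} : Set (Set (FracSemilinear.Space 1))),
            v ∈ FracSemilinear.D0 Ω' s} s q := by
        simpa using hcomp.embeds hq1 hΩ.measurableSet
      obtain ⟨C, hC, h⟩ := FracSemilinear.exists_eLpNorm_top_le_of_embeds hs0 hs1 hs hq1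
        (by linarith) (by linarith) hemb
      exact ⟨C, hC, fun lam _ u hu => h Ω rfl hΩ hcomp lam u hu⟩
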